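/- Let $F$ be a totally real number field of degree $d$ with ring of integers $\mathcal{O}_F$. For $x\in F$ and a real embedding $\sigma$ of $F$ write $x^\sigma=\sigma(x)$. For $\ell\in\mathcal{O}_F$ put $|\ell|_\infty=\max_\sigma|\ell^\sigma|$ and $N(\ell)=|N_{F/\mathbb{Q}}(\ell)|$. For a polynomial $P=\sum_{\mathbf n}\alpha_{\mathbf n}\mathbf x^{\mathbf n}$ over $\mathcal{O}_F$ put $H(P)=\sum_\sigma\sum_{\mathbf n}|\alpha_{\mathbf n}^\sigma|$. An integral quadratic form in $n$ variables over $F$ is a form $Q(\mathbf x)=\frac12\sum_{1\le i,j\le n}a_{ij}x_ix_j$ with $a_{ij}=a_{ji}\in\mathcal{O}_F$ and $a_{jj}\in2\mathcal{O}_F$; its discriminant is $\Delta=\det(a_{ij})$. It is totally positive definite if the real quadratic form $Q^\sigma$ is positive definite for every $\sigma$. Let $r_Q(\ell)$ be the number of $\mathbf x\in\mathcal{O}_F^n$ with $Q(\mathbf x)=\ell$. Let $\varepsilon>0$. (a) Let $P(x,y)\in\mathcal{O}_F[x,y]$ be a polynomial of degree $2$ whose homogeneous part of degree $2$ is a totally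 positive definite quadratic form, and let $\ell\in\mathcal{O}_F$. Then the equation $P(x,y)=\ell$ has only finitely many solutions $(x,y)\in\mathcal{O}_F^2$, and their number is $\ll\bigl(H(P)(1+|\ell|_\infty)\bigr)^{\varepsilon}$. (b) Let $Q$ be a totally positive definite integral ternary quadratic form over $F$ of discriminant $\Delta$, and let $\ell\in\mathcal{O}_F\setminus\{0\}$. Then $r_Q(\ell)$ is finite and $r_Q(\ell)\ll N(\ell)^{1/2}\bigl(|\ell|_\infty N(\Delta)\bigr)^{\varepsilon}$. (c) Let $Q$ be a totally positive definite integral quaternary quadratic form over $F$ of discriminant $\Delta$, and let $\ell\in\mathcal{O}_F\setminus\{0\}$. Then $r_Q(\ell)$ is finite and $r_Q(\ell)\ll N(\ell)\bigl(|\ell|_\infty N(\Delta)\bigr)^{\varepsilon}$. All implied constants depend only on $F$ and $\varepsilon$. -/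

import Mathlib

open NumberField

noncomputable section

namespace TotReal

variable {F : Type*} [Field F] [NumberField F]

/-- The conjugate `x ^ σ` of an algebraic integer `x` under a real embedding `σ`,
as a ring homomorphism `𝓞 F → ℝ`. -/
def conj (σ : F →+* ℝ) : 𝓞 F →+* ℝ := σ.comp (algebraMap (𝓞 F) F)

/-- `|ℓ|_∞ = max_σ |ℓ ^ σ|`, over all real embeddings `σ` of `F`
(a finite nonempty family when `F` is totally real). -/
def supAbs (l : 𝓞 F) : ℝ := ⨆ σ : F →+* ℝ, |conj σ l|

/-- The absolute norm `N(x) = |N_{F/ℚ}(x)|` of an algebraic integer, as a real number. -/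
def absNorm (x : 𝓞 F) : ℝ := |((Algebra.norm ℤ x : ℤ) : ℝ)|

/-- The height `H(P) = ∑_σ ∑_n |α_n ^ σ|` of a polynomial with coefficients `α_n` in `𝓞 F`,
`σ` running over all real embeddings of `F`. -/
def height {k : ℕ} (P : MvPolynomial (Fin k) (𝓞 F)) : ℝ :=
  ∑ σ : F →+* ℝ, ∑ n ∈ P.support, |conj σ (P.coeff n)|

/-- The homogeneous part of degree two of `P` is a totally positive definite quadratic form:
each of its conjugates is positive at every nonzero real vector. -/
def HasTotPosDefQuadPart {k : ℕ} (P : MvPolynomial (Fin k) (𝓞 F)) : Prop :=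
  ∀ σ : F →+* ℝ, ∀ v : Fin k → ℝ, v ≠ 0 →
    0 < (MvPolynomial.homogeneousComponent 2 P).eval₂ (conj σ) v

/-- The solutions of `P(x) = ℓ` in algebraic integers. -/
def solutions {k : ℕ} (P : MvPolynomial (Fin k) (𝓞 F)) (l : 𝓞 F) : Set (Fin k → 𝓞 F) :=
  {v | MvPolynomial.eval v P = l}

/-- The symmetric matrix `A = (a_ij)` with `Q(x) = (1/2) ∑ a_ij x_i x_j`, that is
`a_ij = Q(e_i + e_j) - Q(e_i) - Q(e_j)`; its entries are in `𝓞 F`, its diagonal in `2 𝓞 F`. -/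
def formMatrix {n : ℕ} (Q : QuadraticForm (𝓞 F) (Fin n → 𝓞 F)) : Matrix (Fin n) (Fin n) (𝓞 F) :=
  Matrix.of fun i j => QuadraticMap.polar Q (Pi.single i 1) (Pi.single j 1)

/-- The determinant (discriminant) `Δ = det A` of an integral quadratic form. -/
def disc {n : ℕ} (Q : QuadraticForm (𝓞 F) (Fin n → 𝓞 F)) : 𝓞 F := (formMatrix Q).det

/-- `Q` is totally positive definite: `Q ^ σ` is positive definite for all real embeddings. -/
def TotPosDef {n : ℕ} (Q : QuadraticForm (𝓞 F) (Fin n → 𝓞 F)) : Prop :=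
  ∀ σ : F →+* ℝ, ((formMatrix Q).map (conj σ)).PosDef

/-- The integral representations of `ℓ` by `Q`. -/
def representations {n : ℕ} (Q : QuadraticForm (𝓞 F) (Fin n → 𝓞 F)) (l : 𝓞 F) :
    Set (Fin n → 𝓞 F) :=
  {x | Q x = l}

/-- The representation number `r_Q(ℓ)`. -/
def repNum {n : ℕ} (Q : QuadraticForm (𝓞 F) (Fin n → 𝓞 F)) (l : 𝓞 F) : ℕ :=
  (representations Q l).ncard

end TotReal

end

/-!
All three bounds rest on a divisor bound that is uniform in the field. If `E` is totally positive in
`F`, a solution of `E X² + Y² = M` gives a divisor `Y + X √-E` of `M` in the ring of integers of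
`K = F(√-E)`. The number of ideal divisors of `M` is `≪ N(M) ^ ε` with a constant depending only on
`ε` and on the degree of `K` (`exists_ideal_divisor_bound`), because a field of bounded degree has
boundedly many primes of small norm. Two elements which generate the same ideal and have the same
absolute values differ by a unit that has absolute value one at all places, and such units are
distinct modulo `3`, which bounds their number (`card_generators_le`). Completing squares turns any
binary quadratic equation with totally positive definite quadratic part into this shape, with `M`
polynomially bounded by the coefficients (`exists_binary_bound`). This is the bound for polynomials
in two variables.

For forms in `k + 2` variables, `k = 1, 2`, the sphere `Q = ℓ` is cut into plane sections. By
Minkowski's theorem the dual form has `k` independent integral vectors `φ` at which all conjugates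
are bounded by a constant depending only on `F` (`exists_two_functionals`). By the Cauchy-Schwarz
inequality a point of the sphere satisfies `|φ(x) ^ σ| ≪ √(ℓ ^ σ)`. A box with these sides contains
`≪ N(ℓ) ^ (1 / 2)` integers, whatever its shape (`card_box_le`), so `≪ N(ℓ) ^ (k / 2)` plane
sections cover the sphere. A plane section has at most two points, or else three of its points form
an affine frame of the plane. In that frame the section is given by a binary equation whose
coefficients are polynomials in `|ℓ|_∞`, without any dependence on `Q`, so that it has
`≪ |ℓ|_∞ ^ ε` points (`exists_plane_section_bound`). No reduction theory is needed.
-/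

namespace TotReal

/-! ### Real embeddings of a totally real field -/

section Embeddings

variable {F : Type*} [Field F]

theorem conj_injective (σ : F →+* ℝ) : Function.Injective (conj σ) :=
  σ.injective.comp RingOfIntegers.coe_injective

theorem exists_real_embedding [IsTotallyReal F] (φ : F →+* ℂ) :
    ∃ σ : F →+* ℝ, ∀ x, φ x = (σ x : ℂ) := by
  have h : ComplexEmbedding.IsReal φ := by
    rw [← InfinitePlace.isReal_mk_iff]
    exact IsTotallyReal.isReal _
  exact ⟨h.embedding, fun x => (h.coe_embedding_apply x).symm⟩

/-- The real embeddings of a totally real field are its complex embeddings. -/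
noncomputable def realEmbeddingEquiv (F : Type*) [Field F] [IsTotallyReal F] :
    (F →+* ℝ) ≃ (F →+* ℂ) :=
  Equiv.ofBijective (fun σ => Complex.ofRealHom.comp σ)
    ⟨fun σ τ h => RingHom.ext fun x => Complex.ofReal_injective (RingHom.congr_fun h x),
      fun φ => by
        obtain ⟨σ, hσ⟩ := exists_real_embedding φ
        exact ⟨σ, RingHom.ext fun x => (hσ x).symm⟩⟩

theorem supAbs_nonneg (x : 𝓞 F) : 0 ≤ supAbs x :=
  Real.iSup_nonneg fun _ => abs_nonneg _

variable [NumberField F]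

theorem one_le_absNorm {x : 𝓞 F} (hx : x ≠ 0) : 1 ≤ absNorm x := by
  unfold absNorm
  have : Algebra.norm ℤ x ≠ 0 := Algebra.norm_ne_zero_iff.mpr hx
  exact_mod_cast Int.one_le_abs this

theorem abs_conj_le_supAbs (σ : F →+* ℝ) (x : 𝓞 F) : |conj σ x| ≤ supAbs x :=
  le_ciSup (f := fun σ : F →+* ℝ => |conj σ x|) (Set.finite_range _).bddAbove σ

/-- The conjugates of an integral basis form an invertible matrix: by Dedekind's independence of
characters its rows are independent. -/
theorem linearIndependent_conj_basis :
    LinearIndependent ℝ fun (σ : F →+* ℝ) (b : Module.Free.ChooseBasisIndex ℤ (𝓞 F)) =>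
      conj σ (RingOfIntegers.basis F b) := by
  rw [Fintype.linearIndependent_iff]
  intro g hg
  have h := (linearIndependent_monoidHom F ℝ).comp
    (fun σ : F →+* ℝ => (σ : F →* ℝ)) (fun σ τ h => RingHom.ext fun x => DFunLike.congr_fun h x)
  rw [Fintype.linearIndependent_iff] at h
  refine h g ?_
  -- a combination of embeddings is additive, so it is determined on an integral basis
  let f : F →ₗ[ℚ] ℝ := ∑ σ : F →+* ℝ, g σ • σ.toRatAlgHom.toLinearMap
  have hf : f = 0 := by
    refine (integralBasis F).ext fun b => ?_
    have := congr_fun hg b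
    simpa [f, conj, integralBasis_apply] using this
  ext x
  have := LinearMap.congr_fun hf x
  simpa [f] using this

variable [IsTotallyReal F]

theorem card_real_embeddings : Fintype.card (F →+* ℝ) = Module.finrank ℚ F := by
  rw [Fintype.card_congr (realEmbeddingEquiv F), Embeddings.card]

theorem card_real_embeddings_pos : 0 < Fintype.card (F →+* ℝ) := by
  rw [card_real_embeddings]
  exact Module.finrank_pos

instance : Nonempty (F →+* ℝ) := Fintype.card_pos_iff.mp card_real_embeddings_pos

theorem prod_abs_conj (x : 𝓞 F) : ∏ σ : F →+* ℝ, |conj σ x| = absNorm x := by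
  have h := Algebra.norm_eq_prod_embeddings ℚ ℂ (x : F)
  rw [← Algebra.coe_norm_int] at h
  have h2 : ∏ σ : F →ₐ[ℚ] ℂ, σ (x : F) = ∏ σ : F →+* ℝ, ((conj σ x : ℝ) : ℂ) := by
    rw [← (RingHom.equivRatAlgHom F ℂ).prod_comp, ← (realEmbeddingEquiv F).prod_comp]
    rfl
  rw [h2, ← Complex.ofReal_prod] at h
  rw [← Finset.abs_prod, absNorm]
  congr 1
  apply Complex.ofReal_injective
  rw [← h]
  simp

theorem eq_zero_of_prod_abs_conj_lt_one {x : 𝓞 F} (h : ∏ σ : F →+* ℝ, |conj σ x| < 1) :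
    x = 0 := by
  by_contra hx
  have := one_le_absNorm hx
  rw [prod_abs_conj] at h
  linarith

theorem absNorm_le_supAbs_pow (x : 𝓞 F) :
    absNorm x ≤ supAbs x ^ Fintype.card (F →+* ℝ) := by
  rw [← prod_abs_conj]
  refine (Finset.prod_le_prod (fun _ _ => abs_nonneg _)
    fun σ _ => abs_conj_le_supAbs σ x).trans ?_
  simp [Finset.card_univ]

theorem one_le_supAbs {x : 𝓞 F} (hx : x ≠ 0) : 1 ≤ supAbs x := by
  by_contra h
  have h1 := pow_lt_one₀ (supAbs_nonneg x) (not_le.mp h) (card_real_embeddings_pos (F := F)).ne'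
  linarith [one_le_absNorm hx, absNorm_le_supAbs_pow x]

end Embeddings

/-! ### Divisor bounds uniform in the field -/

section Divisors

open UniqueFactorizationMonoid

theorem exists_add_one_le_mul_rpow {ε : ℝ} (hε : 0 < ε) :
    ∃ K : ℝ, 1 ≤ K ∧ ∀ (e : ℕ) (q : ℝ), 2 ≤ q → (e + 1 : ℝ) ≤ K * (q ^ e) ^ ε := by
  refine ⟨max 1 (1 / (ε * Real.log 2)), le_max_left _ _, fun e q hq => ?_⟩
  set K := max 1 (1 / (ε * Real.log 2))
  have h2 : 0 < Real.log 2 := Real.log_pos one_lt_two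
  have h1 : (1 : ℝ) + e * (ε * Real.log 2) ≤ ((2 : ℝ) ^ e) ^ ε := by
    rw [← Real.rpow_natCast, ← Real.rpow_mul (by norm_num), Real.rpow_def_of_pos (by norm_num)]
    have := Real.add_one_le_exp (Real.log 2 * (e * ε))
    linarith
  have h3 : ((2 : ℝ) ^ e) ^ ε ≤ (q ^ e) ^ ε := by gcongr
  have hK1 : 1 ≤ K := le_max_left _ _
  have hK2 : 1 ≤ K * (ε * Real.log 2) := by
    have := le_max_right 1 (1 / (ε * Real.log 2))
    rwa [div_le_iff₀ (by positivity)] at this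
  calc (e + 1 : ℝ) ≤ K * (1 + e * (ε * Real.log 2)) := by
        have : (e : ℝ) * 1 ≤ e * (K * (ε * Real.log 2)) := by gcongr
        linarith
    _ ≤ _ := by gcongr; exact h1.trans h3

theorem add_one_le_rpow_of_two_le {ε q : ℝ} (hq : 2 ≤ q ^ ε) (hq0 : 0 ≤ q) (e : ℕ) :
    (e + 1 : ℝ) ≤ (q ^ e) ^ ε := by
  have h : (q ^ e) ^ ε = (q ^ ε) ^ e := by
    rw [← Real.rpow_natCast, ← Real.rpow_natCast, ← Real.rpow_mul hq0, ← Real.rpow_mul hq0,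
      mul_comm]
  rw [h]
  calc (e + 1 : ℝ) ≤ 2 ^ e := by exact_mod_cast Nat.lt_two_pow_self
    _ ≤ _ := by gcongr

variable {K : Type*} [Field K] [NumberField K]

theorem two_le_absNorm_of_prime {p : Ideal (𝓞 K)} (hp : Prime p) : 2 ≤ Ideal.absNorm p := by
  have h0 : Ideal.absNorm p ≠ 0 := Ideal.absNorm_ne_zero_iff_mem_nonZeroDivisors.mpr
    (mem_nonZeroDivisors_of_ne_zero hp.ne_zero)
  have h1 : Ideal.absNorm p ≠ 1 := fun h => hp.not_isUnit (by
    rw [Ideal.isUnit_iff]; exact Ideal.absNorm_eq_one_iff.mp h)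
  omega

/-- A set of prime ideals of norm at most `B` has fewer than `(B!) ^ [K : ℚ]` elements, since their
product divides `B!`. -/
theorem card_primes_lt (s : Finset (Ideal (𝓞 K))) (hs : ∀ p ∈ s, Prime p) (B : ℕ)
    (hB : ∀ p ∈ s, Ideal.absNorm p ≤ B) :
    s.card < (Nat.factorial B) ^ Module.finrank ℚ K := by
  have hdvd : ∏ p ∈ s, p ∣ Ideal.span {((Nat.factorial B : ℕ) : 𝓞 K)} := by
    refine Finset.prod_primes_dvd _ hs fun p hp => ?_
    rw [Ideal.dvd_span_singleton]
    obtain ⟨c, hc⟩ := Nat.dvd_factorial (zero_lt_two.trans_le (two_le_absNorm_of_prime (hs p hp)))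
      (hB p hp)
    rw [hc, Nat.cast_mul]
    exact Ideal.mul_mem_right _ _ (Ideal.absNorm_mem p)
  have h1 := map_dvd Ideal.absNorm hdvd
  rw [Ideal.absNorm_span_natCast, map_prod, RingOfIntegers.rank] at h1
  have h2 := Nat.le_of_dvd (by positivity) h1
  refine lt_of_lt_of_le ?_ h2
  calc s.card < 2 ^ s.card := Nat.lt_two_pow_self
    _ ≤ ∏ p ∈ s, Ideal.absNorm p :=
      Finset.pow_card_le_prod _ _ _ fun p hp => two_le_absNorm_of_prime (hs p hp)

/-- The divisor bound for ideals, uniform over all number fields of bounded degree: the number of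
divisors is `∏ (e_p + 1)`, and `e_p + 1 ≤ N(p) ^ (ε e_p)` except at the primes with `N(p) ^ ε < 2`,
whose number is bounded in terms of the degree and `ε`. -/
theorem exists_ideal_divisor_bound {ε : ℝ} (hε : 0 < ε) (D : ℕ) :
    ∃ C : ℝ, 1 ≤ C ∧ ∀ (K : Type*) [Field K] [NumberField K], Module.finrank ℚ K ≤ D →
      ∀ I : Ideal (𝓞 K), I ≠ ⊥ → {J : Ideal (𝓞 K) | J ∣ I}.Finite ∧
        ({J : Ideal (𝓞 K) | J ∣ I}.ncard : ℝ) ≤ C * (Ideal.absNorm I : ℝ) ^ ε := by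
  classical
  obtain ⟨A, hA1, hA⟩ := exists_add_one_le_mul_rpow hε
  set B : ℕ := ⌈(2 : ℝ) ^ (1 / ε)⌉₊
  set m : ℕ := (Nat.factorial B) ^ D
  refine ⟨A ^ m, one_le_pow₀ hA1, fun K _ _ hD I hI => ?_⟩
  set s := normalizedFactors I
  have hmaps : Set.MapsTo normalizedFactors {J : Ideal (𝓞 K) | J ∣ I}
      (Finset.Iic s : Finset (Multiset (Ideal (𝓞 K)))) := by
    intro J hJ
    have hJ0 : J ≠ 0 := fun h => hI (by rw [Set.mem_ofPred_eq, h, zero_dvd_iff] at hJ; exact hJ)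
    simpa using (dvd_iff_normalizedFactors_le_normalizedFactors hJ0 hI).mp hJ
  have hinj : Set.InjOn normalizedFactors {J : Ideal (𝓞 K) | J ∣ I} := by
    intro J hJ J' hJ' h
    have hJ0 : J ≠ 0 := fun h => hI (by rw [Set.mem_ofPred_eq, h, zero_dvd_iff] at hJ; exact hJ)
    have hJ0' : J' ≠ 0 := fun h => hI (by rw [Set.mem_ofPred_eq, h, zero_dvd_iff] at hJ'; exact hJ')
    rw [← Ideal.prod_normalizedFactors_eq_self hJ0, ← Ideal.prod_normalizedFactors_eq_self hJ0', h]
  refine ⟨Set.Finite.of_finite_image ((Finset.finite_toSet _).subset hmaps.image_subset) hinj, ?_⟩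
  have hcard : {J : Ideal (𝓞 K) | J ∣ I}.ncard ≤ ∏ p ∈ s.toFinset, (s.count p + 1) := by
    rw [← Multiset.card_Iic, ← Set.ncard_coe_finset]
    exact Set.ncard_le_ncard_of_injOn _ hmaps hinj (Finset.finite_toSet _)
  have hprime : ∀ p ∈ s.toFinset, Prime p := fun p hp =>
    prime_of_normalized_factor p (Multiset.mem_toFinset.mp hp)
  have hnorm : (Ideal.absNorm I : ℝ) ^ ε
      = ∏ p ∈ s.toFinset, ((Ideal.absNorm p : ℝ) ^ (s.count p)) ^ ε := by
    rw [Real.finsetProd_rpow _ _ fun _ _ => by positivity]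
    congr 1
    conv_lhs => rw [← Ideal.prod_normalizedFactors_eq_self hI]
    rw [Finset.prod_multiset_count, map_prod]
    push_cast [map_pow]
    rfl
  set t := s.toFinset.filter fun p => (Ideal.absNorm p : ℝ) ^ ε < 2
  have ht : t.card ≤ m := by
    refine (card_primes_lt t (fun p hp => hprime p (Finset.mem_filter.mp hp).1) B
      fun p hp => ?_).le.trans ?_
    · have h := (Finset.mem_filter.mp hp).2
      have : (Ideal.absNorm p : ℝ) ≤ (2 : ℝ) ^ (1 / ε) := by
        rw [one_div, Real.le_rpow_inv_iff_of_pos (by positivity) (by positivity) hε]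
        exact h.le
      exact_mod_cast this.trans (Nat.le_ceil _)
    · exact Nat.pow_le_pow_right (Nat.factorial_pos _) hD
  calc ({J : Ideal (𝓞 K) | J ∣ I}.ncard : ℝ)
      ≤ ∏ p ∈ s.toFinset, ((s.count p : ℝ) + 1) := by exact_mod_cast hcard
    _ ≤ ∏ p ∈ s.toFinset, ((if (Ideal.absNorm p : ℝ) ^ ε < 2 then A else 1) *
          ((Ideal.absNorm p : ℝ) ^ (s.count p)) ^ ε) := by
        refine Finset.prod_le_prod (fun _ _ => by positivity) fun p hp => ?_
        split_ifs with h
        · exact hA _ _ (by exact_mod_cast two_le_absNorm_of_prime (hprime p hp))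
        · rw [one_mul]
          exact add_one_le_rpow_of_two_le (not_lt.mp h) (by positivity) _
    _ = A ^ t.card * (Ideal.absNorm I : ℝ) ^ ε := by
        rw [Finset.prod_mul_distrib, hnorm, Finset.prod_ite]
        simp [t]
    _ ≤ A ^ m * (Ideal.absNorm I : ℝ) ^ ε := by gcongr

theorem norm_embeddings_lt_one {x : 𝓞 K} (h : ∀ τ : K →+* ℂ, ‖τ x‖ < 1) : x = 0 := by
  by_contra hx
  have h0 : (Algebra.norm ℤ x : ℤ) ≠ 0 := Algebra.norm_ne_zero_iff.mpr hx
  have h1 := Algebra.norm_eq_prod_embeddings ℚ ℂ (x : K)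
  rw [← Algebra.coe_norm_int] at h1
  have h2 : ‖∏ σ : K →ₐ[ℚ] ℂ, σ (x : K)‖ < 1 := by
    rw [norm_prod]
    have : Nonempty (K →ₐ[ℚ] ℂ) :=
      (RingHom.equivRatAlgHom K ℂ).nonempty_congr.mp inferInstance
    calc ∏ σ : K →ₐ[ℚ] ℂ, ‖σ (x : K)‖ < ∏ σ : K →ₐ[ℚ] ℂ, 1 := by
          refine Finset.prod_lt_prod_of_nonempty (fun σ _ => ?_)
            (fun σ _ => h (σ : K →+* ℂ)) Finset.univ_nonempty
          rw [norm_pos_iff, map_ne_zero]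
          exact RingOfIntegers.coe_ne_zero_iff.mpr hx
      _ = 1 := by simp
  rw [← h1] at h2
  have h3 : |((Algebra.norm ℤ x : ℤ) : ℝ)| < 1 := by
    simpa using h2
  have h4 := Int.one_le_abs h0
  have h5 : |(Algebra.norm ℤ x : ℤ)| < 1 := by exact_mod_cast h3
  omega

/-- There are few generators of an ideal with prescribed absolute values: the unit relating two of
them has absolute value one at all places, and such units are distinct modulo `3`. -/
theorem card_generators_le (s : Finset (𝓞 K)) (w : 𝓞 K) (hw : w ≠ 0)
    (hspan : ∀ z ∈ s, Ideal.span {z} = Ideal.span {w})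
    (habs : ∀ z ∈ s, ∀ τ : K →+* ℂ, ‖τ z‖ = ‖τ w‖) : s.card ≤ 3 ^ Module.finrank ℚ K := by
  classical
  have hu : ∀ z ∈ s, ∃ u : 𝓞 K, z = u * w := fun z hz => by
    obtain ⟨u, hu⟩ := Ideal.span_singleton_eq_span_singleton.mp (hspan z hz).symm
    exact ⟨u, by rw [← hu, mul_comm]⟩
  choose! u hu using hu
  have hu1 : ∀ z ∈ s, ∀ τ : K →+* ℂ, ‖τ (u z)‖ = 1 := fun z hz τ => by
    have h := habs z hz τ
    rw [hu z hz, RingOfIntegers.coe_eq_algebraMap, map_mul, map_mul, norm_mul] at h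
    have hw0 : ‖τ w‖ ≠ 0 := by
      rw [norm_ne_zero_iff, map_ne_zero]
      exact RingOfIntegers.coe_ne_zero_iff.mpr hw
    exact mul_right_cancel₀ hw0 (by rw [h, one_mul])
  let I : Ideal (𝓞 K) := Ideal.span {((3 : ℕ) : 𝓞 K)}
  have hIcard : Nat.card (𝓞 K ⧸ I) = 3 ^ Module.finrank ℚ K := by
    have := Ideal.absNorm_span_natCast (S := 𝓞 K) 3
    rwa [RingOfIntegers.rank, Ideal.absNorm_apply, Submodule.cardQuot_apply] at this
  have : Finite (𝓞 K ⧸ I) := Nat.finite_of_card_ne_zero (by rw [hIcard]; positivity)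
  have := Fintype.ofFinite (𝓞 K ⧸ I)
  rw [← hIcard, Nat.card_eq_fintype_card, ← Finset.card_univ]
  refine Finset.card_le_card_of_injOn (fun z => Ideal.Quotient.mk I (u z))
    (fun _ _ => Finset.mem_coe.mpr (Finset.mem_univ _)) fun z hz z' hz' h => ?_
  obtain ⟨v, hv⟩ := Ideal.mem_span_singleton'.mp (Ideal.Quotient.eq.mp h)
  have hv0 : v = 0 := by
    refine norm_embeddings_lt_one fun τ => ?_
    have h1 : ‖τ (u z - u z' : 𝓞 K)‖ ≤ 2 := by
      rw [RingOfIntegers.coe_eq_algebraMap, map_sub, map_sub]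
      refine (norm_sub_le _ _).trans ?_
      rw [hu1 z hz, hu1 z' hz']
      norm_num
    rw [← hv, RingOfIntegers.coe_eq_algebraMap, map_mul, map_mul, norm_mul] at h1
    have h3 : ‖τ (algebraMap (𝓞 K) K ((3 : ℕ) : 𝓞 K))‖ = 3 := by
      rw [map_natCast, map_natCast, Complex.norm_natCast]
      norm_num
    rw [h3] at h1
    linarith
  rw [hu z hz, hu z' hz', sub_eq_zero.mp (by rw [← hv, hv0, zero_mul] : u z - u z' = 0)]

/-- The number of divisors `z` of `M` with `|z|² = |M|` at all places, uniformly over all number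
fields of bounded degree. -/
theorem exists_divisor_bound {ε : ℝ} (hε : 0 < ε) (D : ℕ) :
    ∃ C : ℝ, 1 ≤ C ∧ ∀ (K : Type*) [Field K] [NumberField K], Module.finrank ℚ K ≤ D →
      ∀ M : 𝓞 K, M ≠ 0 → ∀ S : Set (𝓞 K),
        (∀ z ∈ S, z ∣ M ∧ ∀ τ : K →+* ℂ, ‖τ z‖ ^ 2 = ‖τ M‖) →
        S.Finite ∧ (S.ncard : ℝ) ≤ C * (Ideal.absNorm (Ideal.span {M}) : ℝ) ^ ε := by
  classical
  obtain ⟨C, hC1, hC⟩ := exists_ideal_divisor_bound hε D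
  refine ⟨3 ^ D * C, one_le_mul_of_one_le_of_one_le (one_le_pow₀ (by norm_num)) hC1,
    fun K _ _ hD M hM S hS => ?_⟩
  obtain ⟨hfin, hcard⟩ := hC K hD (Ideal.span {M}) (by simpa using hM)
  -- it is enough to bound the finite subsets
  have key : ∀ s : Finset (𝓞 K), (s : Set (𝓞 K)) ⊆ S →
      s.card ≤ 3 ^ D * {J : Ideal (𝓞 K) | J ∣ Ideal.span {M}}.ncard := by
    intro s hs
    rw [Set.ncard_eq_toFinset_card _ hfin]
    refine Finset.card_le_mul_card_image_of_maps_to (f := fun z => Ideal.span {z})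
      (fun z hz => ?_) _ fun J _ => ?_
    · simpa [Ideal.dvd_span_singleton, Ideal.mem_span_singleton] using (hS z (hs hz)).1
    · rcases (s.filter fun z => Ideal.span {z} = J).eq_empty_or_nonempty with h | ⟨w, hw⟩
      · rw [h]; simp
      · have hw' := Finset.mem_filter.mp hw
        have hw0 : w ≠ 0 := fun h => hM (by
          have := (hS w (hs hw'.1)).1
          rwa [h, zero_dvd_iff] at this)
        refine (card_generators_le _ w hw0 (fun z hz => ?_) fun z hz τ => ?_).trans
          (Nat.pow_le_pow_right (by norm_num) hD)
        · rw [(Finset.mem_filter.mp hz).2, hw'.2]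
        · have h1 := (hS z (hs (Finset.mem_filter.mp hz).1)).2 τ
          have h2 := (hS w (hs hw'.1)).2 τ
          exact (sq_eq_sq₀ (norm_nonneg _) (norm_nonneg _)).mp (h1.trans h2.symm)
  have hSfin : S.Finite := by
    by_contra h
    obtain ⟨s, hs, hs'⟩ := Set.Infinite.exists_subset_card_eq h
      (3 ^ D * {J : Ideal (𝓞 K) | J ∣ Ideal.span {M}}.ncard + 1)
    have := key s hs
    omega
  refine ⟨hSfin, ?_⟩
  have h := key hSfin.toFinset (by simp)
  rw [← Set.ncard_eq_toFinset_card S hSfin] at h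
  calc (S.ncard : ℝ) ≤ 3 ^ D * ({J : Ideal (𝓞 K) | J ∣ Ideal.span {M}}.ncard : ℝ) := by
        exact_mod_cast h
    _ ≤ 3 ^ D * (C * (Ideal.absNorm (Ideal.span {M}) : ℝ) ^ ε) := by gcongr
    _ = _ := by ring

end Divisors

/-! ### Binary quadratic equations -/

section Binary

open IntermediateField

theorem absNorm_span_le {K : Type*} [Field K] [NumberField K] (x : 𝓞 K) {R : ℝ}
    (hR : ∀ τ : K →+* ℂ, ‖τ x‖ ≤ R) :
    (Ideal.absNorm (Ideal.span {x}) : ℝ) ≤ R ^ Module.finrank ℚ K := by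
  have h1 := Algebra.norm_eq_prod_embeddings ℚ ℂ (x : K)
  rw [← Algebra.coe_norm_int] at h1
  have h2 : (Ideal.absNorm (Ideal.span {x}) : ℝ) = ∏ τ : K →ₐ[ℚ] ℂ, ‖τ (x : K)‖ := by
    rw [← norm_prod, ← h1, Ideal.absNorm_span_singleton, Nat.cast_natAbs]
    simp
  rw [h2, ← AlgHom.card ℚ K ℂ, ← Finset.card_univ, ← Finset.prod_const]
  exact Finset.prod_le_prod (fun _ _ => norm_nonneg _) fun τ _ => hR τ

theorem eq_zero_of_norm_form_eq_zero {F : Type*} [Field F] {E X Y : 𝓞 F}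
    (σ : F →+* ℝ) (hE : 0 < conj σ E) (h : E * X ^ 2 + Y ^ 2 = 0) : X = 0 ∧ Y = 0 := by
  have h1 := congrArg (conj σ) h
  simp only [map_add, map_mul, map_pow, map_zero] at h1
  have hX : conj σ X = 0 := by
    by_contra hX
    have : 0 < conj σ E * conj σ X ^ 2 := by positivity
    nlinarith [sq_nonneg (conj σ Y)]
  have hY : conj σ Y = 0 := by
    rw [hX] at h1
    simpa using h1
  exact ⟨conj_injective σ (by rw [hX, map_zero]), conj_injective σ (by rw [hY, map_zero])⟩

/-- For every integer `E` there is an extension of degree at most two with a square root of `-E`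
among its integers. -/
theorem exists_sqrt_extension (F : Type*) [Field F] [NumberField F] (E : 𝓞 F) :
    ∃ (K : IntermediateField F (AlgebraicClosure F)) (_ : NumberField K) (s : 𝓞 K),
      Module.finrank ℚ K ≤ 2 * Module.finrank ℚ F ∧ s ^ 2 = -algebraMap (𝓞 F) (𝓞 K) E := by
  obtain ⟨t, ht⟩ := IsAlgClosed.exists_pow_nat_eq
    (-algebraMap F (AlgebraicClosure F) (E : F)) zero_lt_two
  have hint : IsIntegral F t := Algebra.IsIntegral.isIntegral t
  have : FiniteDimensional F F⟮t⟯ := adjoin.finiteDimensional hint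
  have : NumberField F⟮t⟯ := NumberField.of_module_finite F F⟮t⟯
  have hs : (AdjoinSimple.gen F t) ^ 2 = -algebraMap F F⟮t⟯ (E : F) := by
    apply Subtype.ext
    simpa using ht
  have hsint : IsIntegral ℤ (AdjoinSimple.gen F t) := by
    refine IsIntegral.of_pow zero_lt_two ?_
    rw [hs]
    exact ((RingOfIntegers.isIntegral_coe E).map (algebraMap F F⟮t⟯).toIntAlgHom).neg
  refine ⟨F⟮t⟯, this, ⟨_, hsint⟩, ?_, ?_⟩
  · rw [← Module.finrank_mul_finrank ℚ F F⟮t⟯, mul_comm]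
    refine Nat.mul_le_mul_right _ ?_
    rw [adjoin.finrank hint]
    refine (Polynomial.natDegree_le_of_dvd (minpoly.dvd F t
      (p := Polynomial.X ^ 2 + Polynomial.C (E : F)) ?_)
      (Polynomial.X_pow_add_C_ne_zero zero_lt_two _)).trans ?_
    · simp [ht]
    · rw [Polynomial.natDegree_X_pow_add_C]
  · apply RingOfIntegers.coe_injective
    simp only [map_neg]
    exact hs

/-- The number of representations by the norm form `Y² + E X²` of `F(√-E)`, uniformly in `E`: a
representation gives a divisor `Y + X √-E` of the number represented. -/
theorem exists_norm_form_bound (F : Type*) [Field F] [NumberField F] [IsTotallyReal F] {ε : ℝ}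
    (hε : 0 < ε) :
    ∃ C : ℝ, 1 ≤ C ∧ ∀ E M : 𝓞 F, (∀ σ, 0 < conj σ E) → ∀ R : ℝ, 1 ≤ R →
      (∀ σ, |conj σ M| ≤ R) → ∀ S : Set (𝓞 F × 𝓞 F),
      (∀ p ∈ S, E * p.1 ^ 2 + p.2 ^ 2 = M) → S.Finite ∧ (S.ncard : ℝ) ≤ C * R ^ ε := by
  set D := 2 * Module.finrank ℚ F
  have hD : 0 < (D : ℝ) := by
    have := Module.finrank_pos (R := ℚ) (M := F)
    positivity
  obtain ⟨C, hC1, hC⟩ := exists_divisor_bound (div_pos hε hD) D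
  refine ⟨C, hC1, fun E M hE R hR hM S hS => ?_⟩
  obtain ⟨σ₀⟩ := (inferInstance : Nonempty (F →+* ℝ))
  rcases eq_or_ne M 0 with rfl | hM0
  · have hsub : S ⊆ {(0, 0)} := fun p hp => by
      obtain ⟨h1, h2⟩ := eq_zero_of_norm_form_eq_zero σ₀ (hE σ₀) (hS p hp)
      exact Prod.ext h1 h2
    refine ⟨(Set.finite_singleton _).subset hsub, ?_⟩
    have h1 : (S.ncard : ℝ) ≤ 1 := by
      exact_mod_cast (Set.ncard_le_ncard hsub).trans (Set.ncard_singleton _).le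
    exact h1.trans (one_le_mul_of_one_le_of_one_le hC1 (Real.one_le_rpow hR hε.le))
  obtain ⟨K, _, s, hK, hs⟩ := exists_sqrt_extension F E
  let ι := algebraMap (𝓞 F) (𝓞 K)
  have hι : Function.Injective ι := FaithfulSMul.algebraMap_injective _ _
  have hτ : ∀ τ : K →+* ℂ, ∃ σ : F →+* ℝ, ∀ x : 𝓞 F, τ (ι x) = (conj σ x : ℂ) := fun τ => by
    obtain ⟨σ, hσ⟩ := exists_real_embedding (τ.comp (algebraMap F K))
    exact ⟨σ, fun x => hσ x⟩
  let f : 𝓞 F × 𝓞 F → 𝓞 K := fun p => ι p.2 + ι p.1 * s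
  have hmul : ∀ X Y : 𝓞 F, (ι Y + ι X * s) * (ι Y - ι X * s) = ι (E * X ^ 2 + Y ^ 2) := by
    intro X Y
    simp only [map_add, map_mul, map_pow]
    linear_combination (-(ι X) ^ 2) * hs
  have hinj : Function.Injective f := by
    intro p q h
    have h0 : E * (p.1 - q.1) ^ 2 + (p.2 - q.2) ^ 2 = 0 := by
      apply hι
      rw [← hmul, map_sub, map_sub, map_zero,
        show ι p.2 - ι q.2 + (ι p.1 - ι q.1) * s = f p - f q by simp only [f]; ring, h, sub_self,
        zero_mul]
    obtain ⟨h1, h2⟩ := eq_zero_of_norm_form_eq_zero σ₀ (hE σ₀) h0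
    exact Prod.ext (sub_eq_zero.mp h1) (sub_eq_zero.mp h2)
  have himage : ∀ z ∈ f '' S, z ∣ ι M ∧ ∀ τ : K →+* ℂ, ‖τ z‖ ^ 2 = ‖τ (ι M)‖ := by
    rintro _ ⟨p, hp, rfl⟩
    refine ⟨⟨_, by rw [hmul, hS p hp]⟩, fun τ => ?_⟩
    obtain ⟨σ, hσ⟩ := hτ τ
    have hss : τ s ^ 2 = ((-conj σ E : ℝ) : ℂ) := by
      have := congrArg (fun x : 𝓞 K => τ x) hs
      simp only [map_pow, map_neg] at this
      rw [Complex.ofReal_neg, ← hσ E]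
      exact this
    -- `τ s` is purely imaginary because its square is negative
    have hre : (τ s).re = 0 := by
      have h1 := congrArg Complex.re hss
      have h2 := congrArg Complex.im hss
      simp only [pow_two, Complex.mul_re, Complex.mul_im, Complex.ofReal_re,
        Complex.ofReal_im] at h1 h2
      by_contra h
      have h3 : (τ s).im = 0 := by
        have : (τ s).re * (τ s).im = 0 := by linarith
        exact (mul_eq_zero.mp this).resolve_left h
      rw [h3] at h1
      nlinarith [hE σ, mul_self_nonneg (τ s).re]
    have him : (τ s).im ^ 2 = conj σ E := by
      have h1 := congrArg Complex.re hss
      simp only [pow_two, Complex.mul_re, Complex.ofReal_re, hre] at h1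
      linarith
    have hz : τ (f p) = (conj σ p.2 : ℂ) + (conj σ p.1 : ℂ) * τ s := by
      rw [← hσ, ← hσ, ← map_mul, ← map_add]
      rfl
    have hMσ : conj σ M = conj σ E * conj σ p.1 ^ 2 + conj σ p.2 ^ 2 := by
      rw [← hS p hp]
      simp
    rw [hσ M, hz, ← Complex.normSq_eq_norm_sq, Complex.normSq_apply, Complex.norm_real,
      Real.norm_eq_abs, hMσ, abs_of_nonneg (by have := hE σ; positivity)]
    simp only [Complex.add_re, Complex.mul_re, Complex.add_im, Complex.mul_im, Complex.ofReal_re,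
      Complex.ofReal_im, hre]
    linear_combination conj σ p.1 ^ 2 * him
  obtain ⟨hfin, hcard⟩ := hC K hK (ι M) ((map_ne_zero_iff ι hι).mpr hM0) (f '' S) himage
  refine ⟨Set.Finite.of_finite_image hfin hinj.injOn, ?_⟩
  rw [Set.ncard_image_of_injective S hinj] at hcard
  refine hcard.trans ?_
  have hN : (Ideal.absNorm (Ideal.span {ι M}) : ℝ) ≤ R ^ D := by
    refine (absNorm_span_le (ι M) fun τ => ?_).trans (pow_le_pow_right₀ hR hK)
    obtain ⟨σ, hσ⟩ := hτ τ
    rw [hσ M, Complex.norm_real]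
    exact hM σ
  have hpow : ((R : ℝ) ^ D) ^ (ε / D) = R ^ ε := by
    rw [← Real.rpow_natCast, ← Real.rpow_mul (by linarith)]
    congr 1
    field_simp
  rw [← hpow]
  gcongr

/-- Completing squares turns a binary quadratic equation into `E X² + Y² = M` with
`E = 4αγ - β²`, `κ = 2αη - βδ` and `M = κ² - E (4αζ - δ²)`, so `|M|_∞ ≪ H ^ 4`. -/
theorem exists_binary_bound (F : Type*) [Field F] [NumberField F] [IsTotallyReal F] {ε : ℝ}
    (hε : 0 < ε) :
    ∃ C : ℝ, 1 ≤ C ∧ ∀ α β γ δ η ζ : 𝓞 F, (∀ σ, 0 < conj σ α) →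
      (∀ σ, 0 < conj σ (4 * α * γ - β ^ 2)) → ∀ H : ℝ, 1 ≤ H →
      (∀ σ, |conj σ α| ≤ H ∧ |conj σ β| ≤ H ∧ |conj σ γ| ≤ H ∧ |conj σ δ| ≤ H ∧ |conj σ η| ≤ H ∧
        |conj σ ζ| ≤ H) → ∀ S : Set (𝓞 F × 𝓞 F),
      (∀ p ∈ S, α * p.1 ^ 2 + β * p.1 * p.2 + γ * p.2 ^ 2 + δ * p.1 + η * p.2 + ζ = 0) →
      S.Finite ∧ (S.ncard : ℝ) ≤ C * H ^ ε := by
  obtain ⟨C, hC1, hC⟩ := exists_norm_form_bound F (show 0 < ε / 4 by positivity)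
  refine ⟨C * 34 ^ (ε / 4), one_le_mul_of_one_le_of_one_le hC1
    (Real.one_le_rpow (by norm_num) (by positivity)), fun α β γ δ η ζ hα hE H hH hbd S hS => ?_⟩
  obtain ⟨σ₀⟩ := (inferInstance : Nonempty (F →+* ℝ))
  have hα0 : α ≠ 0 := fun h => by simpa [h] using hα σ₀
  set E := 4 * α * γ - β ^ 2 with hEdef
  have hE0 : E ≠ 0 := fun h => by simpa [h] using hE σ₀
  let κ := 2 * α * η - β * δ
  let f : 𝓞 F × 𝓞 F → 𝓞 F × 𝓞 F := fun p => (2 * α * p.1 + β * p.2 + δ, E * p.2 + κ)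
  have hf : Function.Injective f := by
    intro p q h
    have h2 : p.2 = q.2 := mul_left_cancel₀ hE0 (add_right_cancel (congrArg Prod.snd h))
    have h1 := congrArg Prod.fst h
    simp only [f, h2] at h1
    have h1 := mul_left_cancel₀ (mul_ne_zero two_ne_zero hα0)
      (add_right_cancel (add_right_cancel h1))
    exact Prod.ext h1 h2
  have hM : ∀ σ, |conj σ (κ ^ 2 - E * (4 * α * ζ - δ ^ 2))| ≤ 34 * H ^ 4 := by
    intro σ
    obtain ⟨h1, h2, h3, h4, h5, h6⟩ := hbd σ
    have hmul : ∀ {x y a b : ℝ}, |x| ≤ a → |y| ≤ b → |x * y| ≤ a * b := fun hx hy => by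
      rw [abs_mul]
      exact mul_le_mul hx hy (abs_nonneg _) ((abs_nonneg _).trans hx)
    have hκ : |conj σ κ| ≤ 3 * H ^ 2 := by
      have a1 := hmul h1 h5
      have a2 := hmul h2 h4
      simp only [κ, map_sub, map_mul, map_ofNat]
      rw [abs_le] at *
      constructor <;> nlinarith
    have hE' : |conj σ E| ≤ 5 * H ^ 2 := by
      have a1 := hmul h1 h3
      have a2 := hmul h2 h2
      simp only [hEdef, map_sub, map_mul, map_ofNat, map_pow]
      rw [abs_le] at *
      constructor <;> nlinarith
    have hx : |conj σ (4 * α * ζ - δ ^ 2)| ≤ 5 * H ^ 2 := by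
      have a1 := hmul h1 h6
      have a2 := hmul h4 h4
      simp only [map_sub, map_mul, map_ofNat, map_pow]
      rw [abs_le] at *
      constructor <;> nlinarith
    have a1 := hmul hκ hκ
    have a2 := hmul hE' hx
    rw [map_sub, map_mul, map_pow]
    rw [abs_le] at a1 a2 ⊢
    constructor <;> nlinarith
  have hH4 : (1 : ℝ) ≤ 34 * H ^ 4 := by
    have := one_le_pow₀ hH (n := 4)
    linarith
  obtain ⟨hfin, hcard⟩ := hC E (κ ^ 2 - E * (4 * α * ζ - δ ^ 2)) hE _ hH4 hM (f '' S) (by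
    rintro _ ⟨p, hp, rfl⟩
    have := hS p hp
    simp only [f, κ, hEdef]
    linear_combination (4 * α * (4 * α * γ - β ^ 2)) * this)
  refine ⟨Set.Finite.of_finite_image hfin hf.injOn, ?_⟩
  rw [Set.ncard_image_of_injective S hf] at hcard
  refine hcard.trans_eq ?_
  rw [Real.mul_rpow (by norm_num) (by positivity), ← Real.rpow_natCast, ← Real.rpow_mul
    (by linarith), mul_assoc]
  congr 3
  push_cast
  ring

end Binary

/-! ### Minkowski's theorem on linear forms -/

section Minkowski

open MeasureTheory Matrix

/-- Minkowski's theorem on linear forms. -/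
theorem exists_int_mulVec_le {m : Type*} [Fintype m] [DecidableEq m] [Nonempty m]
    (M : Matrix m m ℝ) (hM : M.det ≠ 0) {r : ℝ} (hr : 0 < r) (h : |M.det| < r ^ Fintype.card m) :
    ∃ z : m → ℤ, z ≠ 0 ∧ ∀ i, |(M *ᵥ fun j => (z j : ℝ)) i| ≤ r := by
  let b := Pi.basisFun ℝ m
  let s : Set (m → ℝ) := (Matrix.toLin' M) ⁻¹' Metric.closedBall 0 r
  have hvol : volume (ZSpan.fundamentalDomain b) = 1 := by
    rw [ZSpan.fundamentalDomain_pi_basisFun, Real.volume_pi_Ico]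
    simp
  have hs : volume s = ENNReal.ofReal (|M.det|⁻¹ * (2 * r) ^ Fintype.card m) := by
    rw [Measure.addHaar_preimage_linearMap volume (by rwa [LinearMap.det_toLin']),
      Real.volume_pi_closedBall 0 hr.le, LinearMap.det_toLin', abs_inv,
      ← ENNReal.ofReal_mul (by positivity)]
  have hlt : volume (ZSpan.fundamentalDomain b) * 2 ^ Module.finrank ℝ (m → ℝ) < volume s := by
    have h0 : 0 < |M.det| := abs_pos.mpr hM
    rw [hvol, hs, one_mul, Module.finrank_fintype_fun_eq_card, ENNReal.lt_ofReal_iff_toReal_lt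
      (by finiteness)]
    simp only [ENNReal.toReal_pow, ENNReal.toReal_ofNat]
    rw [mul_pow, inv_mul_eq_div, lt_div_iff₀ h0]
    gcongr
  have : Countable (Submodule.span ℤ (Set.range b)).toAddSubgroup := by
    change Countable (Submodule.span ℤ (Set.range b))
    infer_instance
  obtain ⟨⟨x, hx⟩, hx0, hxs⟩ := exists_ne_zero_mem_lattice_of_measure_mul_two_pow_lt_measure
    (L := (Submodule.span ℤ (Set.range b)).toAddSubgroup)
    (ZSpan.isAddFundamentalDomain b volume) (s := s)
    (fun y hy => by simpa [s, Matrix.mulVec_neg] using hy)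
    ((convex_closedBall 0 r).linear_preimage _) hlt
  have hint : ∀ i, ∃ k : ℤ, (k : ℝ) = x i := fun i => by
    have := (b.mem_span_iff_repr_mem ℤ x).mp hx i
    simpa [b] using this
  choose z hz using hint
  have hzx : (fun j => (z j : ℝ)) = x := funext hz
  refine ⟨z, fun h => hx0 ?_, fun i => ?_⟩
  · ext i
    simp [← hz i, h]
  · rw [hzx]
    have h1 : ‖M *ᵥ x‖ ≤ r := by simpa [s] using hxs
    exact (norm_le_pi_norm (M *ᵥ x) i).trans h1

/-- Minkowski's theorem on linear forms in integers of a totally real field, with an unspecified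
constant in place of the discriminant factor. -/
theorem exists_conj_mulVec_le (F : Type*) [Field F] [NumberField F] [IsTotallyReal F] (n : ℕ)
    [NeZero n] :
    ∃ C : ℝ, 0 < C ∧ ∀ T : (F →+* ℝ) → Matrix (Fin n) (Fin n) ℝ, (∀ σ, (T σ).det ≠ 0) →
      ∀ r : ℝ, 0 < r → C * ∏ σ, |(T σ).det| < r ^ (n * Fintype.card (F →+* ℝ)) →
      ∃ φ : Fin n → 𝓞 F, φ ≠ 0 ∧ ∀ σ i, |(T σ *ᵥ fun j => conj σ (φ j)) i| ≤ r := by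
  classical
  let b := RingOfIntegers.basis F
  have hcard : Fintype.card (F →+* ℝ) =
      Fintype.card (Module.Free.ChooseBasisIndex ℤ (𝓞 F)) := by
    rw [card_real_embeddings, ← RingOfIntegers.rank, Module.finrank_eq_card_chooseBasisIndex]
  let e := Fintype.equivOfCardEq hcard
  let E : Matrix (F →+* ℝ) (F →+* ℝ) ℝ := Matrix.of fun σ τ => conj σ (b (e τ))
  have hE : E.det ≠ 0 := by
    rw [← isUnit_iff_ne_zero, ← Matrix.isUnit_iff_isUnit_det,
      ← Matrix.linearIndependent_rows_iff_isUnit]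
    exact (linearIndependent_conj_basis (F := F)).map' (LinearMap.funLeft ℝ ℝ e)
      (LinearMap.ker_eq_bot.mpr (LinearMap.funLeft_injective_of_surjective _ _ _ e.surjective))
  refine ⟨|E.det| ^ n, by positivity, fun T hT r hr h => ?_⟩
  let M : Matrix (Fin n × (F →+* ℝ)) (Fin n × (F →+* ℝ)) ℝ :=
    blockDiagonal T * kroneckerMap (· * ·) (1 : Matrix (Fin n) (Fin n) ℝ) E
  have hdet : |M.det| = |E.det| ^ n * ∏ σ, |(T σ).det| := by
    rw [det_mul, det_blockDiagonal, det_kronecker, abs_mul, Finset.abs_prod]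
    simp [mul_comm]
  obtain ⟨z, hz0, hz⟩ := exists_int_mulVec_le M (by
      rw [← abs_ne_zero, hdet]
      have : ∏ σ, |(T σ).det| ≠ 0 := Finset.prod_ne_zero_iff.mpr fun σ _ => abs_ne_zero.mpr (hT σ)
      positivity) hr (by
      rw [hdet, Fintype.card_prod, Fintype.card_fin]
      exact h)
  refine ⟨fun j => ∑ τ, z (j, τ) • b (e τ), fun h0 => hz0 ?_, fun σ i => ?_⟩
  · have hli : LinearIndependent ℤ fun τ => b (e τ) := b.linearIndependent.comp e e.injective
    ext ⟨j, τ⟩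
    exact Fintype.linearIndependent_iff.mp hli _ (congr_fun h0 j) τ
  · refine le_of_eq_of_le (congrArg abs ?_) (hz (i, σ))
    rw [← mulVec_mulVec]
    simp [mulVec, dotProduct, Fintype.sum_prod_type, blockDiagonal_apply, one_apply, E, mul_comm,
      Finset.sum_ite_eq]

end Minkowski

/-! ### Integers in boxes -/

section Boxes

variable {F : Type*} [Field F] [NumberField F] [IsTotallyReal F]

/-- The number of integers in a box, whatever its shape. The box is cut into equal cells whose
volume is so small that two integers in the same cell coincide, their difference having norm less
than one. -/
theorem card_box_le (c : (F →+* ℝ) → ℝ) (hc : ∀ σ, 0 < c σ) (h1 : 1 ≤ ∏ σ, c σ) :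
    {a : 𝓞 F | ∀ σ, |conj σ a| ≤ c σ}.Finite ∧
      ({a : 𝓞 F | ∀ σ, |conj σ a| ≤ c σ}.ncard : ℝ) ≤
        4 ^ Fintype.card (F →+* ℝ) * ∏ σ, c σ := by
  classical
  set d := Fintype.card (F →+* ℝ)
  have hd : d ≠ 0 := (card_real_embeddings_pos (F := F)).ne'
  set t : ℝ := (∏ σ, c σ) ^ (d⁻¹ : ℝ)
  have htd : t ^ d = ∏ σ, c σ := Real.rpow_inv_natCast_pow (by linarith) hd
  have ht1 : 1 ≤ t := Real.one_le_rpow h1 (by positivity)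
  set m := ⌈2 * t⌉₊
  have hm1 : 2 * t ≤ m := Nat.le_ceil _
  have hm2 : (m : ℝ) < 2 * t + 1 := Nat.ceil_lt_add_one (by linarith)
  have hm0 : (0 : ℝ) < m := by linarith
  let f : 𝓞 F → (F →+* ℝ) → ℕ := fun a σ => ⌊(conj σ a + c σ) * (m / (2 * c σ))⌋₊
  have hmaps : Set.MapsTo f {a : 𝓞 F | ∀ σ, |conj σ a| ≤ c σ}
      (Fintype.piFinset fun _ : F →+* ℝ => Finset.range (m + 1)) := by
    intro a ha
    simp only [Finset.mem_coe, Fintype.mem_piFinset, Finset.mem_range]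
    intro σ
    have h := abs_le.mp (ha σ)
    have hσ := hc σ
    refine Nat.lt_succ_of_le (Nat.floor_le_of_le ?_)
    rw [mul_div_assoc', div_le_iff₀ (by positivity)]
    nlinarith
  have hinj : Set.InjOn f {a : 𝓞 F | ∀ σ, |conj σ a| ≤ c σ} := by
    intro a ha b hb hab
    rw [← sub_eq_zero]
    refine eq_zero_of_prod_abs_conj_lt_one ?_
    have hlt : ∀ σ, |conj σ (a - b)| < c σ / t := by
      intro σ
      have hσ := hc σ
      have hp : 0 < (m : ℝ) / (2 * c σ) := by positivity
      have h := congr_fun hab σ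
      have ha0 : 0 ≤ (conj σ a + c σ) * (m / (2 * c σ)) :=
        mul_nonneg (by linarith [(abs_le.mp (ha σ)).1]) hp.le
      have hb0 : 0 ≤ (conj σ b + c σ) * (m / (2 * c σ)) :=
        mul_nonneg (by linarith [(abs_le.mp (hb σ)).1]) hp.le
      have a1 := Nat.floor_le ha0
      have a2 := Nat.lt_floor_add_one ((conj σ a + c σ) * (m / (2 * c σ)))
      have b1 := Nat.floor_le hb0
      have b2 := Nat.lt_floor_add_one ((conj σ b + c σ) * (m / (2 * c σ)))
      simp only [f] at h
      rw [h] at a1 a2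
      have key : |conj σ (a - b)| * (m / (2 * c σ)) < 1 := by
        have habs : |conj σ (a - b)| * (m / (2 * c σ)) = |conj σ (a - b) * (m / (2 * c σ))| := by
          rw [abs_mul, abs_of_pos hp]
        rw [habs, map_sub, abs_lt]
        constructor <;> linarith
      rw [lt_div_iff₀ (by linarith)]
      rw [mul_div_assoc', div_lt_one (by positivity)] at key
      nlinarith [abs_nonneg (conj σ (a - b))]
    calc ∏ σ, |conj σ (a - b)| < ∏ σ, c σ / t := by
          by_cases h0 : a - b = 0
          · rw [h0]
            refine lt_of_eq_of_lt ?_ (Finset.prod_pos fun σ _ => div_pos (hc σ) (by linarith))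
            simp [Fintype.card_pos.ne', Finset.card_univ]
          · refine Finset.prod_lt_prod_of_nonempty (fun σ _ => abs_pos.mpr ?_)
              (fun σ _ => hlt σ) Finset.univ_nonempty
            exact (map_ne_zero_iff _ (conj_injective σ)).mpr h0
      _ = 1 := by
          rw [Finset.prod_div_distrib, Finset.prod_const, Finset.card_univ, htd, div_self]
          linarith
  have hfin := Set.Finite.of_finite_image ((Finset.finite_toSet _).subset hmaps.image_subset) hinj
  refine ⟨hfin, ?_⟩
  have hcard := Set.ncard_le_ncard_of_injOn f hmaps hinj (Finset.finite_toSet _)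
  rw [Set.ncard_coe_finset, Fintype.card_piFinset, Finset.prod_const, Finset.card_univ,
    Finset.card_range] at hcard
  calc ({a : 𝓞 F | ∀ σ, |conj σ a| ≤ c σ}.ncard : ℝ) ≤ ((m : ℝ) + 1) ^ d := by
        exact_mod_cast hcard
    _ ≤ (4 * t) ^ d := by
        gcongr
        linarith
    _ = 4 ^ d * ∏ σ, c σ := by rw [mul_pow, htd]

end Boxes

/-! ### Short vectors of the dual form -/

section Functionals

open Matrix

theorem exists_transpose_mul_self {n : ℕ} {A : Matrix (Fin n) (Fin n) ℝ} (hA : A.PosDef) :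
    ∃ U : Matrix (Fin n) (Fin n) ℝ, A = Uᵀ * U ∧ U.det ≠ 0 := by
  open scoped MatrixOrder in
  obtain ⟨U, hU⟩ := CStarAlgebra.nonneg_iff_eq_star_mul_self.mp hA.posSemidef.nonneg
  have hU' : A = Uᵀ * U := by
    rw [hU, star_eq_conjTranspose, conjTranspose_eq_transpose_of_trivial]
  refine ⟨U, hU', fun h => ?_⟩
  have := hA.det_pos
  rw [hU', det_mul, h, mul_zero] at this
  exact lt_irrefl _ this

theorem dotProduct_sq_le {n : ℕ} (x y : Fin n → ℝ) : (x ⬝ᵥ y) ^ 2 ≤ (x ⬝ᵥ x) * (y ⬝ᵥ y) := by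
  have := Finset.sum_mul_sq_le_sq_mul_sq Finset.univ x y
  simpa [dotProduct, pow_two] using this

/-- The linear map that stretches the direction of the unit vector `e` by `τ`. -/
def stretch {n : ℕ} (τ : ℝ) (e : Fin n → ℝ) : Matrix (Fin n) (Fin n) ℝ :=
  1 + replicateCol Unit ((τ - 1) • e) * replicateRow Unit e

theorem stretch_mulVec {n : ℕ} (τ : ℝ) (e y : Fin n → ℝ) :
    stretch τ e *ᵥ y = y + ((τ - 1) * (e ⬝ᵥ y)) • e := by
  ext i
  rw [stretch, add_mulVec, one_mulVec, ← mulVec_mulVec]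
  simp [-mulVec_mulVec, mulVec, dotProduct]
  ring

theorem det_stretch {n : ℕ} (τ : ℝ) {e : Fin n → ℝ} (he : e ⬝ᵥ e = 1) :
    (stretch τ e).det = τ := by
  rw [stretch, det_one_add_replicateCol_mul_replicateRow, dotProduct_smul, he]
  simp

theorem dotProduct_self_le_stretch {n : ℕ} {τ : ℝ} (hτ : 1 ≤ τ) {e : Fin n → ℝ}
    (he : e ⬝ᵥ e = 1) (y : Fin n → ℝ) :
    y ⬝ᵥ y ≤ (stretch τ e *ᵥ y) ⬝ᵥ (stretch τ e *ᵥ y) := by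
  rw [stretch_mulVec]
  simp only [dotProduct_add, add_dotProduct, smul_dotProduct, dotProduct_smul, he, smul_eq_mul,
    dotProduct_comm y e]
  nlinarith [mul_nonneg (show 0 ≤ τ ^ 2 - 1 by nlinarith) (sq_nonneg (e ⬝ᵥ y))]

theorem dotProduct_self_le_of_abs_le {n : ℕ} {y : Fin n → ℝ} {r : ℝ} (h : ∀ i, |y i| ≤ r) :
    y ⬝ᵥ y ≤ n * r ^ 2 := by
  calc y ⬝ᵥ y ≤ ∑ _i : Fin n, r ^ 2 := by
        refine Finset.sum_le_sum fun i _ => ?_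
        rw [← pow_two]
        exact sq_le_sq' (by linarith [(abs_le.mp (h i)).1]) (abs_le.mp (h i)).2
    _ = _ := by simp

variable {F : Type*} [Field F] [NumberField F] [IsTotallyReal F]

/-- The dual form of an integral form takes values in `Δ⁻¹ 𝓞 F`, so the product of the conjugates of
a nonzero value, here `q σ`, is at least `N(Δ)⁻¹`. -/
theorem one_le_absNorm_det_mul_prod {n : ℕ} (A : Matrix (Fin n) (Fin n) (𝓞 F))
    (q : (F →+* ℝ) → ℝ) (φ : Fin n → 𝓞 F)
    (hq : ∀ σ, conj σ A.det * q σ = conj σ (φ ⬝ᵥ A.adjugate *ᵥ φ))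
    (h0 : ∀ σ, 0 < q σ) (hdet : A.det ≠ 0) : 1 ≤ absNorm A.det * ∏ σ, q σ := by
  have h : absNorm (φ ⬝ᵥ A.adjugate *ᵥ φ) = absNorm A.det * ∏ σ, q σ := by
    rw [← prod_abs_conj, ← prod_abs_conj, ← Finset.prod_mul_distrib]
    refine Finset.prod_congr rfl fun σ _ => ?_
    rw [← hq, abs_mul, abs_of_pos (h0 σ)]
  rw [← h]
  refine one_le_absNorm fun h0' => ?_
  obtain ⟨σ⟩ := (inferInstance : Nonempty (F →+* ℝ))
  have := hq σ
  rw [h0', map_zero] at this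
  exact (mul_ne_zero ((map_ne_zero_iff _ (conj_injective σ)).mpr hdet) (h0 σ).ne') this

/-- The dual of an integral positive form has two independent vectors at which all its conjugates
are bounded. The first comes from Minkowski's theorem. For the second, Minkowski's theorem is
applied after stretching the direction of the first one so far that its multiples are too long to be
found; that this costs little rests on the lower bound for the values of the dual form. -/
theorem exists_two_functionals (F : Type*) [Field F] [NumberField F] [IsTotallyReal F] (n : ℕ)
    (hn : 2 ≤ n) :
    ∃ K : ℝ, 1 ≤ K ∧ ∀ A : Matrix (Fin n) (Fin n) (𝓞 F), (∀ σ, (A.map (conj σ)).PosDef) →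
      ∃ φ : Fin 2 → Fin n → 𝓞 F, LinearIndependent (𝓞 F) φ ∧
        ∀ i σ (x : Fin n → 𝓞 F), conj σ (φ i ⬝ᵥ x) ^ 2 ≤ K * conj σ (x ⬝ᵥ A *ᵥ x) := by
  classical
  have : NeZero n := ⟨by omega⟩
  obtain ⟨C, hC0, hC⟩ := exists_conj_mulVec_le F n
  set d := Fintype.card (F →+* ℝ) with hd
  have hd0 : d ≠ 0 := (card_real_embeddings_pos (F := F)).ne'
  have hn' : (2 : ℝ) ≤ n := by exact_mod_cast hn
  set s : ℝ := √(2 * n)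
  have hs2 : s ^ 2 = 2 * n := Real.sq_sqrt (by positivity)
  have hs1 : 1 ≤ s := Real.one_le_sqrt.mpr (by linarith)
  set r : ℝ := 1 + C * s ^ d
  have hCs : C * s ^ d < r := by simp [r]
  have hr1 : 1 ≤ r := by
    have : 0 ≤ C * s ^ d := by positivity
    linarith
  have hr0 : 0 < r := by linarith
  refine ⟨n * r ^ 2, by nlinarith, fun A hA => ?_⟩
  choose U hU hUdet using fun σ => exists_transpose_mul_self (hA σ)
  have hdetσ : ∀ σ, conj σ A.det = (U σ).det ^ 2 := fun σ => by
    rw [RingHom.map_det, RingHom.mapMatrix_apply, hU, det_mul, det_transpose, pow_two]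
  have hdet0 : A.det ≠ 0 := fun h => by
    obtain ⟨σ⟩ := (inferInstance : Nonempty (F →+* ℝ))
    have := hdetσ σ
    rw [h, map_zero] at this
    exact pow_ne_zero 2 (hUdet σ) this.symm
  set N := absNorm A.det with hN
  have hN1 : 1 ≤ N := one_le_absNorm hdet0
  let T := fun σ => ((U σ)ᵀ)⁻¹
  have hTU : ∀ σ, (U σ)ᵀ * T σ = 1 := fun σ =>
    mul_nonsing_inv _ (by rw [det_transpose]; exact (hUdet σ).isUnit)
  have hTdet : ∀ σ, (T σ).det ≠ 0 := fun σ h => by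
    have := congrArg det (hTU σ)
    simp [h] at this
  -- the product of the determinants is `N ^ (-1/2)`
  have hprod : √N * ∏ σ, |(T σ).det| = 1 := by
    have h1 : √N = ∏ σ, |(U σ).det| := by
      rw [Real.sqrt_eq_iff_mul_self_eq (by linarith) (by positivity), ← Finset.prod_mul_distrib, hN,
        ← prod_abs_conj]
      refine Finset.prod_congr rfl fun σ _ => ?_
      rw [hdetσ, abs_pow, pow_two]
    rw [h1, ← Finset.prod_mul_distrib]
    refine Finset.prod_eq_one fun σ _ => ?_
    rw [← abs_mul, ← det_transpose (U σ), ← det_mul, hTU, det_one, abs_one]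
  have hprod0 : 0 ≤ ∏ σ, |(T σ).det| := by positivity
  have hprod1 : ∏ σ, |(T σ).det| ≤ 1 := by
    have : 1 ≤ √N := Real.one_le_sqrt.mpr hN1
    nlinarith
  let v := fun (σ : F →+* ℝ) (φ : Fin n → 𝓞 F) => T σ *ᵥ fun j => conj σ (φ j)
  have hvne : ∀ σ φ, φ ≠ 0 → v σ φ ≠ 0 := fun σ φ hφ h => hφ (by
    have h1 := congrArg (fun w => (U σ)ᵀ *ᵥ w) h
    simp only [v, mulVec_mulVec, hTU, one_mulVec, mulVec_zero] at h1
    ext j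
    have := congr_fun h1 j
    rw [conj_injective σ (by rw [this]; simp : conj σ (φ j) = conj σ 0)]
    rfl)
  have hvpos : ∀ σ φ, φ ≠ 0 → 0 < v σ φ ⬝ᵥ v σ φ := fun σ φ hφ =>
    lt_of_le_of_ne (Finset.sum_nonneg fun i _ => mul_self_nonneg _)
      fun h => hvne σ φ hφ (dotProduct_self_eq_zero.mp h.symm)
  have hlower : ∀ φ, φ ≠ 0 → 1 ≤ N * ∏ σ, (v σ φ ⬝ᵥ v σ φ) := fun φ hφ => by
    refine one_le_absNorm_det_mul_prod A _ φ (fun σ => ?_) (fun σ => hvpos σ φ hφ) hdet0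
    have hadj : A.adjugate.map (conj σ) = conj σ A.det • ((T σ)ᵀ * T σ) := by
      have h1 : (A.map (conj σ)) * ((T σ)ᵀ * T σ) = 1 := by
        rw [hU, Matrix.mul_assoc, ← Matrix.mul_assoc (U σ), ← transpose_transpose (U σ),
          ← transpose_mul, transpose_transpose, mul_eq_one_comm.mp (hTU σ), transpose_one,
          Matrix.one_mul, hTU]
      have h2 : A.adjugate.map (conj σ) * A.map (conj σ) = conj σ A.det • 1 := by
        rw [← RingHom.mapMatrix_apply, ← RingHom.mapMatrix_apply, ← map_mul, adjugate_mul]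
        ext i j
        simp [one_apply, apply_ite (conj σ)]
      calc A.adjugate.map (conj σ)
          = A.adjugate.map (conj σ) * (A.map (conj σ) * ((T σ)ᵀ * T σ)) := by
            rw [h1, Matrix.mul_one]
        _ = _ := by rw [← Matrix.mul_assoc, h2, smul_mul, Matrix.one_mul]
    have h3 : conj σ (φ ⬝ᵥ A.adjugate *ᵥ φ) =
        (fun j => conj σ (φ j)) ⬝ᵥ (A.adjugate.map (conj σ)) *ᵥ fun j => conj σ (φ j) := by
      simp [dotProduct, mulVec]
    rw [h3, hadj, smul_mulVec, dotProduct_smul, smul_eq_mul, ← mulVec_mulVec,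
      dotProduct_mulVec (fun j => conj σ (φ j)), vecMul_transpose]
  have hbound : ∀ φ, (∀ σ, v σ φ ⬝ᵥ v σ φ ≤ n * r ^ 2) → ∀ σ (x : Fin n → 𝓞 F),
      conj σ (φ ⬝ᵥ x) ^ 2 ≤ n * r ^ 2 * conj σ (x ⬝ᵥ A *ᵥ x) := by
    intro φ hφ σ x
    set x' := fun j => conj σ (x j)
    have h1 : conj σ (φ ⬝ᵥ x) = v σ φ ⬝ᵥ U σ *ᵥ x' := by
      have h : (U σ)ᵀ *ᵥ v σ φ = fun j => conj σ (φ j) := by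
        simp only [v, mulVec_mulVec, hTU, one_mulVec]
      rw [dotProduct_mulVec, ← mulVec_transpose, h]
      simp [dotProduct, x']
    have h2 : conj σ (x ⬝ᵥ A *ᵥ x) = (U σ *ᵥ x') ⬝ᵥ (U σ *ᵥ x') := by
      have h : conj σ (x ⬝ᵥ A *ᵥ x) = x' ⬝ᵥ (A.map (conj σ)) *ᵥ x' := by
        simp [dotProduct, mulVec, x']
      rw [h, hU, ← mulVec_mulVec, dotProduct_mulVec, vecMul_transpose]
    rw [h1, h2]
    exact (dotProduct_sq_le _ _).trans (mul_le_mul_of_nonneg_right (hφ σ)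
      (Finset.sum_nonneg fun i _ => mul_self_nonneg _))
  have hs1d : 1 ≤ s ^ d := one_le_pow₀ hs1
  have hrpow : r ^ d * r ≤ r ^ (n * d) := by
    rw [← pow_succ]
    refine pow_le_pow_right₀ hr1 ?_
    have := Nat.mul_le_mul_right d hn
    omega
  have hrd1 : 1 ≤ r ^ d := one_le_pow₀ hr1
  obtain ⟨φ₁, hφ₁, hφ₁r⟩ := hC T hTdet r hr0 (by
    calc C * ∏ σ, |(T σ).det| ≤ C * s ^ d := by gcongr; linarith
      _ < r := hCs
      _ ≤ r ^ d * r := le_mul_of_one_le_left hr0.le hrd1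
      _ ≤ _ := hrpow)
  let e := fun σ => (√(v σ φ₁ ⬝ᵥ v σ φ₁))⁻¹ • v σ φ₁
  have he : ∀ σ, e σ ⬝ᵥ e σ = 1 := fun σ => by
    have h := hvpos σ φ₁ hφ₁
    simp only [e, smul_dotProduct, dotProduct_smul, smul_eq_mul]
    rw [← mul_assoc, ← mul_inv, Real.mul_self_sqrt h.le, inv_mul_cancel₀ h.ne']
  -- stretched by this factor, the nonzero multiples of `φ₁` are too long to satisfy the bound, as
  -- their dual forms have product at least `1 / N` over the embeddings
  set τ : ℝ := s * r * √(N ^ (d⁻¹ : ℝ))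
  have hNd : (N ^ (d⁻¹ : ℝ)) ^ d = N := Real.rpow_inv_natCast_pow (by linarith) hd0
  have hNd1 : 1 ≤ N ^ (d⁻¹ : ℝ) := Real.one_le_rpow hN1 (by positivity)
  have hτ1 : 1 ≤ τ := one_le_mul_of_one_le_of_one_le (one_le_mul_of_one_le_of_one_le hs1 hr1)
    (Real.one_le_sqrt.mpr hNd1)
  have hτd : τ ^ d = s ^ d * r ^ d * √N := by
    rw [mul_pow, mul_pow]
    congr 1
    rw [eq_comm, Real.sqrt_eq_iff_mul_self_eq (by linarith) (by positivity), ← mul_pow,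
      Real.mul_self_sqrt (by linarith), hNd]
  have hτ2 : τ ^ 2 = 2 * (n * r ^ 2) * N ^ (d⁻¹ : ℝ) := by
    rw [mul_pow, mul_pow, hs2, Real.sq_sqrt (by linarith)]
    ring
  obtain ⟨φ₂, hφ₂, hφ₂r⟩ := hC (fun σ => stretch τ (e σ) * T σ)
    (fun σ => by
      rw [det_mul, det_stretch τ (he σ)]
      exact mul_ne_zero (by linarith) (hTdet σ)) r hr0 (by
    simp only [det_mul, det_stretch τ (he _), abs_mul, Finset.prod_mul_distrib, Finset.prod_const,
      Finset.card_univ]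
    rw [abs_of_pos (by linarith), ← hd, hτd]
    calc C * (s ^ d * r ^ d * √N * ∏ σ, |(T σ).det|)
        = C * s ^ d * r ^ d * (√N * ∏ σ, |(T σ).det|) := by ring
      _ = C * s ^ d * r ^ d := by rw [hprod, mul_one]
      _ < r * r ^ d := by gcongr
      _ = r ^ d * r := mul_comm _ _
      _ ≤ _ := hrpow)
  have hstretch : ∀ σ, (stretch τ (e σ) *ᵥ v σ φ₂) ⬝ᵥ (stretch τ (e σ) *ᵥ v σ φ₂) ≤ n * r ^ 2 :=
    fun σ => dotProduct_self_le_of_abs_le fun i => by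
      simp only [v, mulVec_mulVec]
      exact hφ₂r σ i
  refine ⟨![φ₁, φ₂], ?_, ?_⟩
  · rw [LinearIndependent.pair_iff]
    intro a b hab
    by_cases hb : b = 0
    · refine ⟨?_, hb⟩
      rw [hb, zero_smul, add_zero, smul_eq_zero] at hab
      exact hab.resolve_right hφ₁
    exfalso
    have hlong : ∀ σ, τ ^ 2 * (v σ φ₂ ⬝ᵥ v σ φ₂) ≤ n * r ^ 2 := by
      intro σ
      have hb' : conj σ b ≠ 0 := (map_ne_zero_iff _ (conj_injective σ)).mpr hb
      have hφ : (fun j => conj σ (φ₂ j)) =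
          (-conj σ a / conj σ b) • fun j => conj σ (φ₁ j) := by
        ext j
        have h := congrArg (conj σ) (congr_fun hab j)
        simp only [Pi.add_apply, Pi.smul_apply, smul_eq_mul, map_add, map_mul, Pi.zero_apply,
          map_zero] at h ⊢
        field_simp
        linear_combination h
      have hv : v σ φ₂ = (-conj σ a / conj σ b) • v σ φ₁ := by
        simp only [v, hφ, mulVec_smul]
      have hv' : v σ φ₂ = (-conj σ a / conj σ b * √(v σ φ₁ ⬝ᵥ v σ φ₁)) • e σ := by
        have h := (Real.sqrt_pos.mpr (hvpos σ φ₁ hφ₁)).ne'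
        rw [hv]
        simp only [e]
        rw [smul_smul, mul_assoc, mul_inv_cancel₀ h, mul_one]
      have h := hstretch σ
      rw [stretch_mulVec] at h
      rw [hv'] at h ⊢
      simp only [dotProduct_add, add_dotProduct, smul_dotProduct, dotProduct_smul, he,
        smul_eq_mul] at h ⊢
      nlinarith
    have h1 : (τ ^ 2) ^ d * ∏ σ, (v σ φ₂ ⬝ᵥ v σ φ₂) ≤ (n * r ^ 2) ^ d := by
      have := Finset.prod_le_prod (s := Finset.univ)
        (fun σ _ => mul_nonneg (sq_nonneg τ) (hvpos σ φ₂ hφ₂).le) fun σ _ => hlong σ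
      rwa [Finset.prod_mul_distrib, Finset.prod_const, Finset.prod_const, Finset.card_univ] at this
    have h2 := hlower φ₂ hφ₂
    rw [hτ2, mul_pow, hNd, mul_pow] at h1
    have h3 : 0 < ((n : ℝ) * r ^ 2) ^ d := by positivity
    have h4 : (2 : ℝ) ≤ 2 ^ d := le_self_pow₀ one_le_two hd0
    have h5 : 2 * ((n : ℝ) * r ^ 2) ^ d ≤ 2 ^ d * (n * r ^ 2) ^ d *
        (N * ∏ σ, (v σ φ₂ ⬝ᵥ v σ φ₂)) := by
      calc 2 * ((n : ℝ) * r ^ 2) ^ d ≤ 2 ^ d * (n * r ^ 2) ^ d * 1 := by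
            rw [mul_one]; gcongr
        _ ≤ _ := by gcongr
    nlinarith
  · intro i
    fin_cases i
    · exact hbound φ₁ fun σ => dotProduct_self_le_of_abs_le fun i => hφ₁r σ i
    · exact hbound φ₂ fun σ =>
        (dotProduct_self_le_stretch hτ1 (he σ) (v σ φ₂)).trans (hstretch σ)

end Functionals

/-! ### Spheres of a quadratic form over a ring -/

section Spheres

open QuadraticMap

variable {R V : Type*} [CommRing R] [AddCommGroup V] [Module R V] (Q : QuadraticForm R V)

theorem quadraticForm_lincomb (a b : R) (x y : V) :
    Q (a • x + b • y) = a ^ 2 * Q x + a * b * polar Q x y + b ^ 2 * Q y := by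
  rw [QuadraticMap.map_add Q, QuadraticMap.map_smul, QuadraticMap.map_smul, polar_smul_left,
    polar_smul_right]
  simp only [smul_eq_mul]
  ring

theorem polar_lincomb_left (a b : R) (x y z : V) :
    polar Q (a • x + b • y) z = a * polar Q x z + b * polar Q y z := by
  rw [polar_add_left, polar_smul_left, polar_smul_left, smul_eq_mul, smul_eq_mul]

/-- The Gram determinant of two vectors, relative to the polar form. -/
def gram (x y : V) : R := 4 * Q x * Q y - polar Q x y ^ 2

theorem quadraticForm_orthogonalize (x y : V) :
    Q ((2 * Q x) • y + (-polar Q x y) • x) = Q x * gram Q x y := by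
  rw [quadraticForm_lincomb, polar_comm Q y x, gram]
  ring

/-- Three distinct points of a sphere are not collinear. -/
theorem gram_ne_zero_of_sphere [IsDomain R] [CharZero R] [Module.IsTorsionFree R V]
    (hQ : ∀ x, Q x = 0 → x = 0) {v u w : V}
    (hu : Q (v + u) = Q v) (hw : Q (v + w) = Q v) (hu0 : u ≠ 0) (hw0 : w ≠ 0) (huw : u ≠ w) :
    gram Q u w ≠ 0 := by
  intro hG
  have hqu : Q u ≠ 0 := fun h => hu0 (hQ u h)
  have hqw : Q w ≠ 0 := fun h => hw0 (hQ w h)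
  rw [QuadraticMap.map_add Q] at hu hw
  have h1 : (2 * Q u) • w + (-polar Q u w) • u = 0 := by
    apply hQ
    rw [quadraticForm_orthogonalize, hG, mul_zero]
  have h2 := polar_lincomb_left Q (2 * Q u) (-polar Q u w) w u v
  rw [h1, polar_zero_left, polar_comm Q w v, polar_comm Q u v] at h2
  have h3 : Q u * (2 * Q w - polar Q u w) = 0 := by
    linear_combination h2 + (2 * Q u) * hw - polar Q u w * hu
  have h4 : polar Q u w = 2 * Q w := by
    linear_combination -((mul_eq_zero.mp h3).resolve_left hqu)
  have h5 : Q w * (Q u - Q w) = 0 := by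
    have h4' : (2 * 2 : R) * (Q w * (Q u - Q w)) = 0 := by
      rw [gram, h4] at hG
      linear_combination hG
    exact (mul_eq_zero.mp h4').resolve_left (mul_ne_zero two_ne_zero two_ne_zero)
  have h6 : Q u = Q w := sub_eq_zero.mp ((mul_eq_zero.mp h5).resolve_left hqw)
  rw [h4, h6, neg_smul, ← sub_eq_add_neg, ← smul_sub] at h1
  rcases smul_eq_zero.mp h1 with h | h
  · exact mul_ne_zero two_ne_zero hqw h
  · exact huw (sub_eq_zero.mp h).symm

/-- Coordinates in a plane, up to the factor `gram Q u w`. -/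
theorem gram_smul_eq [IsDomain R] [CharZero R] (hQ : ∀ x, Q x = 0 → x = 0)
    (W : Submodule R V) (hW : ∀ f : Fin 3 → V, (∀ i, f i ∈ W) → ¬LinearIndependent R f)
    {u w y : V} (hu : u ∈ W) (hw : w ∈ W) (hy : y ∈ W) (hG : gram Q u w ≠ 0) :
    gram Q u w • y = (2 * Q w * polar Q u y - polar Q u w * polar Q w y) • u +
      (2 * Q u * polar Q w y - polar Q u w * polar Q u y) • w := by
  set p := 2 * Q w * polar Q u y - polar Q u w * polar Q w y with hp
  set q := 2 * Q u * polar Q w y - polar Q u w * polar Q u y with hq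
  -- the difference is orthogonal to the plane
  set z := gram Q u w • y + (-1 : R) • (p • u + q • w) with hz
  have hzpolar : ∀ t : V, polar Q z t =
      gram Q u w * polar Q y t - (p * polar Q u t + q * polar Q w t) := fun t => by
    rw [hz, polar_lincomb_left, polar_lincomb_left]
    ring
  have hself : ∀ t : V, polar Q t t = 2 * Q t := fun t => by
    rw [polar_self, two_smul, two_mul]
  have hzu : polar Q z u = 0 := by
    rw [hzpolar, hself, polar_comm Q y u, polar_comm Q w u, hp, hq, gram]
    ring
  have hzw : polar Q z w = 0 := by
    rw [hzpolar, hself, polar_comm Q y w, hp, hq, gram]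
    ring
  have hzW : z ∈ W := W.add_mem (W.smul_mem _ hy) (W.smul_mem _
    (W.add_mem (W.smul_mem _ hu) (W.smul_mem _ hw)))
  by_contra hne
  have hz0 : Q z ≠ 0 := fun h => hne (by
    have := hQ z h
    rw [hz, neg_one_smul, ← sub_eq_add_neg] at this
    exact sub_eq_zero.mp this)
  refine hW ![u, w, z] (by
    intro i
    fin_cases i
    · exact hu
    · exact hw
    · exact hzW) ?_
  rw [Fintype.linearIndependent_iff]
  intro g hg
  simp only [Fin.sum_univ_three, Matrix.cons_val_zero, Matrix.cons_val_one, Matrix.cons_val] at hg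
  have hexp : ∀ t : V, g 0 * polar Q u t + g 1 * polar Q w t + g 2 * polar Q z t = 0 := fun t => by
    have h := congrArg (fun x => polar Q x t) hg
    simpa only [polar_add_left, polar_smul_left, polar_zero_left, smul_eq_mul] using h
  have e1 := hexp u
  have e2 := hexp w
  have e3 := hexp z
  rw [hzu, hself, polar_comm Q w u] at e1
  rw [hzw, hself] at e2
  rw [polar_comm Q u z, hzu, polar_comm Q w z, hzw, hself] at e3
  have g2 : g 2 = 0 := by
    have : g 2 * (2 * Q z) = 0 := by linear_combination e3
    exact (mul_eq_zero.mp this).resolve_right (mul_ne_zero two_ne_zero hz0)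
  have g0 : g 0 = 0 := by
    have : g 0 * gram Q u w = 0 := by
      rw [gram]
      linear_combination 2 * Q w * e1 - polar Q u w * e2
    exact (mul_eq_zero.mp this).resolve_right hG
  have g1 : g 1 = 0 := by
    have : g 1 * gram Q u w = 0 := by
      rw [gram]
      linear_combination 2 * Q u * e2 - polar Q u w * e1
    exact (mul_eq_zero.mp this).resolve_right hG
  intro i
  fin_cases i
  · exact g0
  · exact g1
  · exact g2

end Spheres

/-! ### Representations by totally positive definite forms -/

section Forms

open QuadraticMap Matrix

variable {F : Type*} [Field F] {n : ℕ} (Q : QuadraticForm (𝓞 F) (Fin n → 𝓞 F))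

theorem dotProduct_formMatrix_mulVec (x : Fin n → 𝓞 F) :
    x ⬝ᵥ formMatrix Q *ᵥ x = 2 * Q x := by
  have h : formMatrix Q = LinearMap.toMatrix₂' (𝓞 F) (polarBilin Q) := by
    ext i j
    simp [formMatrix]
  rw [h, ← toLinearMap₂'_apply', toLinearMap₂'_toMatrix', polarBilin_apply_apply, polar_self,
    two_smul, two_mul]

variable {Q}

theorem TotPosDef.pos (hQ : TotPosDef Q) (σ : F →+* ℝ) {x : Fin n → 𝓞 F} (hx : x ≠ 0) :
    0 < conj σ (Q x) := by
  have hx' : (fun j => conj σ (x j)) ≠ 0 := fun h => hx (by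
    ext j
    have := congr_fun h j
    rw [conj_injective σ (by rw [this]; simp : conj σ (x j) = conj σ 0)]
    rfl)
  have h := (hQ σ).dotProduct_mulVec_pos hx'
  have h2 : conj σ (x ⬝ᵥ formMatrix Q *ᵥ x) = star (fun j => conj σ (x j)) ⬝ᵥ
      ((formMatrix Q).map (conj σ)) *ᵥ fun j => conj σ (x j) := by
    simp [dotProduct, mulVec]
  rw [← h2, dotProduct_formMatrix_mulVec, map_mul, map_ofNat] at h
  linarith

theorem TotPosDef.nonneg (hQ : TotPosDef Q) (σ : F →+* ℝ) (x : Fin n → 𝓞 F) :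
    0 ≤ conj σ (Q x) := by
  rcases eq_or_ne x 0 with rfl | hx
  · simp
  · exact (hQ.pos σ hx).le

theorem TotPosDef.gram_nonneg (hQ : TotPosDef Q) (σ : F →+* ℝ) (x y : Fin n → 𝓞 F) :
    0 ≤ conj σ (gram Q x y) := by
  rcases eq_or_ne x 0 with rfl | hx
  · simp [gram]
  · have h := hQ.nonneg σ ((2 * Q x) • y + (-polar Q x y) • x)
    rw [quadraticForm_orthogonalize, map_mul] at h
    exact nonneg_of_mul_nonneg_right h (hQ.pos σ hx)

variable [NumberField F]

/-- The common kernel of `k` independent functionals in `k + 2` variables has rank two. -/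
theorem not_linearIndependent_of_functionals {k : ℕ} {φ : Fin k → Fin (k + 2) → 𝓞 F}
    (hφ : LinearIndependent (𝓞 F) φ) (f : Fin 3 → Fin (k + 2) → 𝓞 F)
    (hf : ∀ i j, φ i ⬝ᵥ f j = 0) : ¬LinearIndependent (𝓞 F) f := by
  intro hli
  let ι : (Fin (k + 2) → 𝓞 F) →ₗ[𝓞 F] (Fin (k + 2) → F) :=
    LinearMap.compLeft (Algebra.linearMap (𝓞 F) F) (Fin (k + 2))
  have hι : LinearMap.ker ι = ⊥ := LinearMap.ker_eq_bot.mpr fun x y h => by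
    ext j
    exact congr_fun h j
  have hφ' := (LinearIndependent.iff_fractionRing (𝓞 F) F).mp (hφ.map' ι hι)
  have hf' := (LinearIndependent.iff_fractionRing (𝓞 F) F).mp (hli.map' ι hι)
  let Φ : Matrix (Fin k) (Fin (k + 2)) F := Matrix.of fun i => ι (φ i)
  have hrank : Φ.rank = k := by
    have : LinearIndependent F Φ.row := hφ'
    rw [this.rank_matrix, Fintype.card_fin]
  have hker : Module.finrank F (LinearMap.ker Φ.mulVecLin) = 2 := by
    have h := LinearMap.finrank_range_add_finrank_ker Φ.mulVecLin
    rw [← Matrix.rank, hrank, Module.finrank_fin_fun] at h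
    omega
  have hmem : ∀ j, ι (f j) ∈ LinearMap.ker Φ.mulVecLin := fun j => by
    rw [LinearMap.mem_ker, Matrix.mulVecLin_apply]
    ext i
    have h := congrArg (algebraMap (𝓞 F) F) (hf i j)
    simpa [Φ, ι, mulVec, dotProduct] using h
  have hli' : LinearIndependent F fun j => (⟨ι (f j), hmem j⟩ : LinearMap.ker Φ.mulVecLin) :=
    LinearIndependent.of_comp (LinearMap.ker Φ.mulVecLin).subtype hf'
  have := hli'.fintype_card_le_finrank
  rw [hker] at this
  simp at this

variable [IsTotallyReal F]

theorem TotPosDef.eq_zero (hQ : TotPosDef Q) {x : Fin n → 𝓞 F} (hx : Q x = 0) : x = 0 := by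
  by_contra h
  obtain ⟨σ⟩ := (inferInstance : Nonempty (F →+* ℝ))
  have := hQ.pos σ h
  rw [hx, map_zero] at this
  exact lt_irrefl _ this

theorem TotPosDef.disc_ne_zero (hQ : TotPosDef Q) : disc Q ≠ 0 := fun h => by
  obtain ⟨σ⟩ := (inferInstance : Nonempty (F →+* ℝ))
  have h1 := (hQ σ).det_pos
  rw [← RingHom.mapMatrix_apply, ← RingHom.map_det] at h1
  rw [disc] at h
  rw [h, map_zero] at h1
  exact lt_irrefl _ h1

/-- A plane section of a sphere contains few integral points. Three of its points give an affine
frame of the plane, in which the sphere has an equation with coefficients bounded by its radius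
alone. -/
theorem exists_plane_section_bound (F : Type*) [Field F] [NumberField F] [IsTotallyReal F] (n : ℕ)
    {ε : ℝ} (hε : 0 < ε) :
    ∃ C : ℝ, 1 ≤ C ∧ ∀ Q : QuadraticForm (𝓞 F) (Fin n → 𝓞 F), TotPosDef Q →
      ∀ l : 𝓞 F, l ≠ 0 → ∀ W : Submodule (𝓞 F) (Fin n → 𝓞 F),
      (∀ f : Fin 3 → Fin n → 𝓞 F, (∀ i, f i ∈ W) → ¬LinearIndependent (𝓞 F) f) →
      ∀ S : Set (Fin n → 𝓞 F), (∀ x ∈ S, Q x = l) → (∀ x ∈ S, ∀ y ∈ S, x - y ∈ W) →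
        S.Finite ∧ (S.ncard : ℝ) ≤ C * supAbs l ^ ε := by
  classical
  obtain ⟨C, hC1, hC⟩ := exists_binary_bound F (show 0 < ε / 3 by positivity)
  have h256 : (1 : ℝ) ≤ 256 ^ (ε / 3) := Real.one_le_rpow (by norm_num) (by positivity)
  refine ⟨2 * (C * 256 ^ (ε / 3)), by nlinarith, fun Q hQ l hl W hW S hSl hSW => ?_⟩
  set L := supAbs l
  have hL1 : 1 ≤ L := one_le_supAbs hl
  have hLε : 1 ≤ L ^ ε := Real.one_le_rpow hL1 hε.le
  by_cases h3 : ∃ a ∈ S, ∃ b ∈ S, ∃ c ∈ S, a ≠ b ∧ a ≠ c ∧ b ≠ c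
  swap
  · have hfin : S.Finite := by
      by_contra hinf
      obtain ⟨t, ht, htcard⟩ := Set.Infinite.exists_subset_card_eq hinf 3
      obtain ⟨a, ha, b, hb, c, hc, hab⟩ := Finset.two_lt_card.mp (by omega : 2 < t.card)
      exact h3 ⟨a, ht ha, b, ht hb, c, ht hc, hab⟩
    refine ⟨hfin, ?_⟩
    have h2 : S.ncard ≤ 2 := not_lt.mp fun h => h3 ((Set.two_lt_ncard hfin).mp h)
    calc (S.ncard : ℝ) ≤ 2 := by exact_mod_cast h2
      _ ≤ 2 * (C * 256 ^ (ε / 3)) * L ^ ε := by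
        have : 1 ≤ C * 256 ^ (ε / 3) * L ^ ε := one_le_mul_of_one_le_of_one_le
          (one_le_mul_of_one_le_of_one_le hC1 h256) hLε
        linarith
  obtain ⟨a, ha, b, hb, c, hc, hab, hac, hbc⟩ := h3
  set u := b - a with hu
  set w := c - a with hw
  have hau : Q (a + u) = Q a := by rw [hu, add_sub_cancel, hSl b hb, hSl a ha]
  have haw : Q (a + w) = Q a := by rw [hw, add_sub_cancel, hSl c hc, hSl a ha]
  have hQ0 : ∀ x, Q x = 0 → x = 0 := fun x hx => hQ.eq_zero hx
  have hu0 : u ≠ 0 := sub_ne_zero.mpr hab.symm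
  have hG : gram Q u w ≠ 0 := gram_ne_zero_of_sphere Q hQ0 hau haw hu0
    (sub_ne_zero.mpr hac.symm) fun h => hbc (sub_left_injective h)
  have hpu : polar Q a u = -Q u := by
    rw [QuadraticMap.map_add Q] at hau
    linear_combination hau
  have hpw : polar Q a w = -Q w := by
    rw [QuadraticMap.map_add Q] at haw
    linear_combination haw
  set G := gram Q u w with hGdef
  -- by the parallelogram law, chords of the sphere are at most twice as long as its radius
  have hchord : ∀ x ∈ S, ∀ σ, conj σ (Q (x - a)) ≤ 4 * L := by
    intro x hx σ
    have h1 : Q (x - a) + Q (x + a) = 4 * l := by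
      have e1 := quadraticForm_lincomb Q 1 (-1) x a
      have e2 := quadraticForm_lincomb Q 1 1 x a
      simp only [one_smul, neg_one_smul, ← sub_eq_add_neg, hSl x hx, hSl a ha] at e1 e2
      linear_combination e1 + e2
    have h2 := congrArg (conj σ) h1
    rw [map_add, map_mul, map_ofNat] at h2
    linarith [hQ.nonneg σ (x + a), (le_abs_self _).trans (abs_conj_le_supAbs σ l)]
  have hGle : ∀ σ, 0 ≤ conj σ G ∧ conj σ G ≤ 64 * L ^ 2 ∧ |conj σ (polar Q u w)| ≤ 8 * L := by
    intro σ
    have e0 := hQ.gram_nonneg σ u w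
    have e1 := hchord b hb σ
    have e2 := hchord c hc σ
    have e3 : conj σ G = 4 * conj σ (Q u) * conj σ (Q w) - conj σ (polar Q u w) ^ 2 := by
      rw [hGdef, gram]
      simp only [map_sub, map_mul, map_pow, map_ofNat]
    have e4 : conj σ (Q u) * conj σ (Q w) ≤ 4 * L * (4 * L) :=
      mul_le_mul e1 e2 (hQ.nonneg σ w) (by linarith)
    refine ⟨e0, ?_, ?_⟩
    · rw [e3]
      nlinarith [sq_nonneg (conj σ (polar Q u w))]
    · refine abs_le_of_sq_le_sq ?_ (by linarith)
      rw [← hGdef, e3] at e0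
      nlinarith
  let f : (Fin n → 𝓞 F) → 𝓞 F × 𝓞 F := fun x =>
    (2 * Q w * polar Q u (x - a) - polar Q u w * polar Q w (x - a),
      2 * Q u * polar Q w (x - a) - polar Q u w * polar Q u (x - a))
  have hf : ∀ x ∈ S, G • (x - a) = (f x).1 • u + (f x).2 • w := fun x hx =>
    gram_smul_eq Q hQ0 W hW (hSW b hb a ha) (hSW c hc a ha) (hSW x hx a ha) hG
  have hinj : Set.InjOn f S := by
    intro x hx y hy hxy
    have h := hf x hx
    rw [hxy, ← hf y hy] at h
    exact sub_left_injective (smul_right_injective _ hG h)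
  obtain ⟨hfin, hcard⟩ := hC (Q u) (polar Q u w) (Q w) (-(G * Q u)) (-(G * Q w)) 0
    (fun σ => hQ.pos σ hu0)
    (fun σ => lt_of_le_of_ne (hGle σ).1
      ((map_ne_zero_iff _ (conj_injective σ)).mpr hG).symm) (256 * L ^ 3)
    (by nlinarith [one_le_pow₀ hL1 (n := 3)])
    (fun σ => by
      obtain ⟨g0, g1, g2⟩ := hGle σ
      have e1 := hchord b hb σ
      have e2 := hchord c hc σ
      have p1 := hQ.nonneg σ u
      have p2 := hQ.nonneg σ w
      have q1 : L ≤ L ^ 3 := le_self_pow₀ hL1 (by norm_num)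
      have r1 : conj σ G * conj σ (Q u) ≤ 64 * L ^ 2 * (4 * L) := mul_le_mul g1 e1 p1 (by positivity)
      have r2 : conj σ G * conj σ (Q w) ≤ 64 * L ^ 2 * (4 * L) := mul_le_mul g1 e2 p2 (by positivity)
      have r3 := mul_nonneg g0 p1
      have r4 := mul_nonneg g0 p2
      simp only [map_neg, map_mul, abs_neg, map_zero, abs_zero]
      rw [abs_of_nonneg p1, abs_of_nonneg p2, abs_of_nonneg r3, abs_of_nonneg r4]
      refine ⟨?_, ?_, ?_, ?_, ?_, ?_⟩ <;> nlinarith)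
    (f '' S) (by
      rintro _ ⟨x, hx, rfl⟩
      have h1 : Q (G • x) = Q (G • a + (1 : 𝓞 F) • ((f x).1 • u + (f x).2 • w)) := by
        rw [← hf x hx, one_smul, ← smul_add, add_sub_cancel]
      have h2 : polar Q a ((f x).1 • u + (f x).2 • w) = -((f x).1 * Q u) - (f x).2 * Q w := by
        rw [polar_comm, polar_lincomb_left, polar_comm Q u, polar_comm Q w, hpu, hpw]
        ring
      rw [QuadraticMap.map_smul, hSl x hx, quadraticForm_lincomb, h2, hSl a ha,
        quadraticForm_lincomb, smul_eq_mul] at h1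
      linear_combination -h1)
  refine ⟨Set.Finite.of_finite_image hfin hinj, ?_⟩
  rw [hinj.ncard_image] at hcard
  have hpow : (256 * L ^ 3) ^ (ε / 3) = 256 ^ (ε / 3) * L ^ ε := by
    rw [Real.mul_rpow (by norm_num) (by positivity), ← Real.rpow_natCast, ← Real.rpow_mul
      (by linarith)]
    congr 2
    push_cast
    ring
  rw [hpow] at hcard
  have : 0 ≤ C * (256 ^ (ε / 3) * L ^ ε) := by positivity
  linarith

/-- Functionals bounded by `Q` cut the sphere `Q = l` into few plane sections. -/
theorem exists_representation_bound (F : Type*) [Field F] [NumberField F] [IsTotallyReal F] (k : ℕ)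
    (K : ℝ) (hK : 1 ≤ K) {ε : ℝ} (hε : 0 < ε) :
    ∃ C : ℝ, 0 ≤ C ∧ ∀ Q : QuadraticForm (𝓞 F) (Fin (k + 2) → 𝓞 F), TotPosDef Q →
      ∀ φ : Fin k → Fin (k + 2) → 𝓞 F, LinearIndependent (𝓞 F) φ →
      (∀ i σ x, conj σ (φ i ⬝ᵥ x) ^ 2 ≤ K * conj σ (x ⬝ᵥ formMatrix Q *ᵥ x)) →
      ∀ l : 𝓞 F, l ≠ 0 → (representations Q l).Finite ∧
        (repNum Q l : ℝ) ≤ C * √(absNorm l) ^ k *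
          (supAbs l * absNorm (disc Q)) ^ ε := by
  classical
  obtain ⟨C, hC1, hC⟩ := exists_plane_section_bound F (k + 2) hε
  set d := Fintype.card (F →+* ℝ)
  refine ⟨C * (4 ^ d * √(2 * K) ^ d) ^ k, by positivity, fun Q hQ φ hφ hφb l hl => ?_⟩
  have hL1 := one_le_supAbs hl
  have hN1 := one_le_absNorm hl
  have hΔ1 := one_le_absNorm hQ.disc_ne_zero
  rcases (representations Q l).eq_empty_or_nonempty with hempty | ⟨x₀, hx₀⟩
  · refine ⟨by rw [hempty]; exact Set.finite_empty, ?_⟩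
    rw [repNum, hempty, Set.ncard_empty, Nat.cast_zero]
    have : 0 ≤ supAbs l * absNorm (disc Q) := by nlinarith
    positivity
  have hlpos : ∀ σ, 0 < conj σ l := fun σ => by
    have h0 : x₀ ≠ 0 := fun h => hl (by
      have : Q x₀ = l := hx₀
      rw [← this, h, QuadraticMap.map_zero])
    have := hQ.pos σ h0
    rwa [show Q x₀ = l from hx₀] at this
  let c := fun σ : F →+* ℝ => √(2 * K) * √(conj σ l)
  have hcpos : ∀ σ, 0 < c σ := fun σ =>
    mul_pos (Real.sqrt_pos.mpr (by linarith)) (Real.sqrt_pos.mpr (hlpos σ))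
  have hcprod : ∏ σ, c σ = √(2 * K) ^ d * √(absNorm l) := by
    rw [Finset.prod_mul_distrib, Finset.prod_const, Finset.card_univ]
    congr 1
    rw [eq_comm, Real.sqrt_eq_iff_mul_self_eq (by linarith)
      (Finset.prod_nonneg fun _ _ => Real.sqrt_nonneg _), ← Finset.prod_mul_distrib,
      ← prod_abs_conj]
    refine Finset.prod_congr rfl fun σ _ => ?_
    rw [Real.mul_self_sqrt (hlpos σ).le, abs_of_pos (hlpos σ)]
  have hc1 : 1 ≤ ∏ σ, c σ := by
    rw [hcprod]
    exact one_le_mul_of_one_le_of_one_le (one_le_pow₀ (Real.one_le_sqrt.mpr (by linarith)))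
      (Real.one_le_sqrt.mpr hN1)
  obtain ⟨hboxfin, hboxcard⟩ := card_box_le c hcpos hc1
  set box := hboxfin.toFinset
  let f : (Fin (k + 2) → 𝓞 F) → Fin k → 𝓞 F := fun x i => φ i ⬝ᵥ x
  have hmaps : ∀ x ∈ representations Q l, f x ∈ Fintype.piFinset fun _ : Fin k => box := by
    intro x hx
    rw [Fintype.mem_piFinset]
    intro i
    rw [Set.Finite.mem_toFinset]
    intro σ
    have h := hφb i σ x
    rw [dotProduct_formMatrix_mulVec, show Q x = l from hx, map_mul, map_ofNat] at h
    have hc2 : c σ = √(K * (2 * conj σ l)) := by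
      simp only [c]
      rw [← Real.sqrt_mul (by linarith)]
      congr 1
      ring
    rw [hc2]
    exact Real.abs_le_sqrt h
  let W : Submodule (𝓞 F) (Fin (k + 2) → 𝓞 F) :=
    { carrier := {x | ∀ i, φ i ⬝ᵥ x = 0}
      add_mem' := fun hx hy i => by rw [dotProduct_add, hx i, hy i, add_zero]
      zero_mem' := fun i => dotProduct_zero _
      smul_mem' := fun a x hx i => by rw [dotProduct_smul, hx i, smul_zero] }
  have hfiber : ∀ y, (representations Q l ∩ f ⁻¹' {y}).Finite ∧
      ((representations Q l ∩ f ⁻¹' {y}).ncard : ℝ) ≤ C * supAbs l ^ ε := fun y =>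
    hC Q hQ l hl W
      (fun g hg => not_linearIndependent_of_functionals hφ g fun i j => hg j i) _
      (fun x hx => hx.1) (fun x hx x' hx' i => by
        have h := congr_fun (hx.2.trans hx'.2.symm : f x = f x') i
        rw [dotProduct_sub, sub_eq_zero]
        exact h)
  have hfin : (representations Q l).Finite := Set.Finite.of_finite_fibers f
    ((Finset.finite_toSet _).subset (Set.image_subset_iff.mpr fun x hx =>
      Finset.mem_coe.mpr (hmaps x hx))) fun y _ => (hfiber y).1
  refine ⟨hfin, ?_⟩
  have hcard := Finset.card_le_mul_card_image_of_maps_to (s := hfin.toFinset) (f := f)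
    (fun x hx => hmaps x (hfin.mem_toFinset.mp hx)) ⌊C * supAbs l ^ ε⌋₊ fun y _ => by
      refine Nat.le_floor ?_
      refine le_trans ?_ (hfiber y).2
      rw [Nat.cast_le, ← Set.ncard_coe_finset]
      refine Set.ncard_le_ncard (fun x hx => ?_) (hfiber y).1
      simpa using hx
  rw [Fintype.card_piFinset, Finset.prod_const, Finset.card_univ, Fintype.card_fin,
    ← Set.ncard_eq_toFinset_card _ hfin, ← Set.ncard_eq_toFinset_card _ hboxfin] at hcard
  have hrpow : supAbs l ^ ε ≤ (supAbs l * absNorm (disc Q)) ^ ε := by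
    refine Real.rpow_le_rpow (by linarith) ?_ hε.le
    exact le_mul_of_one_le_right (by linarith) hΔ1
  have hfloor : (⌊C * supAbs l ^ ε⌋₊ : ℝ) ≤ C * supAbs l ^ ε :=
    Nat.floor_le (by have := supAbs_nonneg l; positivity)
  have hpow0 : 0 ≤ supAbs l ^ ε := Real.rpow_nonneg (by linarith) _
  rw [hcprod] at hboxcard
  calc (repNum Q l : ℝ)
      ≤ (⌊C * supAbs l ^ ε⌋₊ : ℝ) *
          ({a : 𝓞 F | ∀ σ, |conj σ a| ≤ c σ}.ncard : ℝ) ^ k := by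
        exact_mod_cast hcard
    _ ≤ (C * supAbs l ^ ε) * (4 ^ d * (√(2 * K) ^ d * √(absNorm l))) ^ k := by gcongr
    _ = C * (4 ^ d * √(2 * K) ^ d) ^ k * √(absNorm l) ^ k * supAbs l ^ ε := by
        rw [← mul_assoc (4 ^ d), mul_pow _ (√(absNorm l))]
        ring
    _ ≤ _ := by gcongr

end Forms

/-! ### Quadratic polynomials in two variables -/

section Polynomials

open MvPolynomial

/-- The exponent of the monomial `x ^ i * y ^ j`. -/
noncomputable def expPair (i j : ℕ) : Fin 2 →₀ ℕ := Finsupp.single 0 i + Finsupp.single 1 j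

theorem eval₂_of_totalDegree_le_two {R S : Type*} [CommSemiring R] [CommSemiring S] (g : R →+* S)
    (v : Fin 2 → S) (P : MvPolynomial (Fin 2) R) (hP : P.totalDegree ≤ 2) :
    P.eval₂ g v = g (P.coeff (expPair 2 0)) * v 0 ^ 2 + g (P.coeff (expPair 1 1)) * v 0 * v 1 +
      g (P.coeff (expPair 0 2)) * v 1 ^ 2 + g (P.coeff (expPair 1 0)) * v 0 +
      g (P.coeff (expPair 0 1)) * v 1 + g (P.coeff (expPair 0 0)) := by
  have hexp : ∀ d : Fin 2 →₀ ℕ, expPair (d 0) (d 1) = d := fun d => by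
    ext i
    fin_cases i <;> simp [expPair]
  have hdeg : ∀ i j, 2 < i + j → P.coeff (expPair i j) = 0 := fun i j hij => by
    by_contra h
    have h1 := le_totalDegree (mem_support_iff.mpr h)
    rw [Finsupp.sum_fintype _ _ fun _ => rfl] at h1
    simp [expPair] at h1
    omega
  have hsum : P.eval₂ g v = ∑ p ∈ Finset.range 3 ×ˢ Finset.range 3,
      g (P.coeff (expPair p.1 p.2)) * (v 0 ^ p.1 * v 1 ^ p.2) := by
    rw [eval₂_eq']
    refine Finset.sum_of_injOn (fun d => (d 0, d 1)) (fun d _ d' _ h => ?_) (fun d hd => ?_)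
      (fun p _ hp => ?_) fun d _ => ?_
    · have h' := Prod.ext_iff.mp h
      simp only at h'
      rw [← hexp d, ← hexp d', h'.1, h'.2]
    · have h1 : d 0 + d 1 ≤ 2 := by
        by_contra h
        have h2 := hdeg (d 0) (d 1) (by omega)
        rw [hexp] at h2
        exact mem_support_iff.mp hd h2
      simp only [Finset.coe_product, Set.mem_prod, Finset.mem_coe, Finset.mem_range]
      omega
    · have : P.coeff (expPair p.1 p.2) = 0 := by
        by_contra h
        exact hp ⟨expPair p.1 p.2, mem_support_iff.mpr h, by simp [expPair]⟩
      rw [this, map_zero, zero_mul]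
    · rw [hexp, Fin.prod_univ_two]
  rw [hsum, Finset.sum_product]
  simp only [Finset.sum_range_succ, Finset.sum_range_zero, hdeg 1 2 (by norm_num),
    hdeg 2 1 (by norm_num), hdeg 2 2 (by norm_num)]
  simp only [map_zero, zero_mul, pow_zero, pow_one, mul_one, one_mul, zero_add, add_zero]
  ring

variable {F : Type*} [Field F]

theorem HasTotPosDefQuadPart.pos {P : MvPolynomial (Fin 2) (𝓞 F)} (hP : HasTotPosDefQuadPart P)
    (σ : F →+* ℝ) : 0 < conj σ (P.coeff (expPair 2 0)) ∧
      0 < conj σ (4 * P.coeff (expPair 2 0) * P.coeff (expPair 0 2)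
        - P.coeff (expPair 1 1) ^ 2) := by
  have hform : ∀ v : Fin 2 → ℝ, v ≠ 0 → 0 < conj σ (P.coeff (expPair 2 0)) * v 0 ^ 2 +
      conj σ (P.coeff (expPair 1 1)) * v 0 * v 1 + conj σ (P.coeff (expPair 0 2)) * v 1 ^ 2 := by
    intro v hv
    have h := hP σ v hv
    rw [eval₂_of_totalDegree_le_two _ _ _
      (homogeneousComponent_isHomogeneous 2 P).totalDegree_le] at h
    simpa [coeff_homogeneousComponent, expPair, Finsupp.degree_eq_sum] using h
  have h1 : 0 < conj σ (P.coeff (expPair 2 0)) := by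
    simpa using hform ![1, 0] (fun h => one_ne_zero (congr_fun h 0))
  refine ⟨h1, ?_⟩
  -- the discriminant appears on completing the square
  have h2 := hform ![-conj σ (P.coeff (expPair 1 1)), 2 * conj σ (P.coeff (expPair 2 0))]
    (fun h => (mul_pos two_pos h1).ne' (congr_fun h 1))
  simp only [Matrix.cons_val_zero, Matrix.cons_val_one] at h2
  simp only [map_sub, map_mul, map_pow, map_ofNat]
  refine pos_of_mul_pos_right (lt_of_lt_of_eq h2 ?_) h1.le
  ring

variable [NumberField F]

theorem abs_conj_coeff_le_height {k : ℕ} (P : MvPolynomial (Fin k) (𝓞 F)) (σ : F →+* ℝ)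
    (d : Fin k →₀ ℕ) : |conj σ (P.coeff d)| ≤ height P := by
  have h1 : ∑ n ∈ P.support, |conj σ (P.coeff n)| ≤ height P :=
    Finset.single_le_sum (f := fun σ : F →+* ℝ => ∑ n ∈ P.support, |conj σ (P.coeff n)|)
      (fun _ _ => Finset.sum_nonneg fun _ _ => abs_nonneg _) (Finset.mem_univ σ)
  refine le_trans ?_ h1
  by_cases hd : d ∈ P.support
  · exact Finset.single_le_sum (f := fun n => |conj σ (P.coeff n)|) (fun _ _ => abs_nonneg _) hd
  · rw [notMem_support_iff.mp hd, map_zero, abs_zero]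
    exact Finset.sum_nonneg fun _ _ => abs_nonneg _

theorem exists_polynomial_bound (F : Type*) [Field F] [NumberField F] [IsTotallyReal F] {ε : ℝ}
    (hε : 0 < ε) :
    ∃ C : ℝ, ∀ P : MvPolynomial (Fin 2) (𝓞 F), P.totalDegree = 2 → HasTotPosDefQuadPart P →
      ∀ l : 𝓞 F, (solutions P l).Finite ∧
        ((solutions P l).ncard : ℝ) ≤ C * (height P * (1 + supAbs l)) ^ ε := by
  obtain ⟨C, -, hC⟩ := exists_binary_bound F hε
  refine ⟨C, fun P hdeg hP l => ?_⟩
  obtain ⟨σ₀⟩ := (inferInstance : Nonempty (F →+* ℝ))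
  have hh1 : 1 ≤ height P := by
    have h0 : P.coeff (expPair 2 0) ≠ 0 := fun h => by
      have := (hP.pos σ₀).1
      rw [h, map_zero] at this
      exact lt_irrefl _ this
    exact (one_le_supAbs h0).trans (ciSup_le fun σ => abs_conj_coeff_le_height P σ _)
  have hl0 := supAbs_nonneg l
  have hle : height P ≤ height P * (1 + supAbs l) := le_mul_of_one_le_right (by linarith)
    (by linarith)
  let f : (Fin 2 → 𝓞 F) → 𝓞 F × 𝓞 F := fun v => (v 0, v 1)
  have hf : Function.Injective f := fun v w h => by
    ext i
    fin_cases i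
    · exact congrArg _ (congrArg Prod.fst h)
    · exact congrArg _ (congrArg Prod.snd h)
  have hcoeff := fun σ d => (abs_conj_coeff_le_height P σ d).trans hle
  obtain ⟨hfin, hcard⟩ := hC (P.coeff (expPair 2 0)) (P.coeff (expPair 1 1))
    (P.coeff (expPair 0 2)) (P.coeff (expPair 1 0)) (P.coeff (expPair 0 1))
    (P.coeff (expPair 0 0) - l) (fun σ => (hP.pos σ).1) (fun σ => (hP.pos σ).2)
    (height P * (1 + supAbs l)) (hh1.trans hle)
    (fun σ => ⟨hcoeff σ _, hcoeff σ _, hcoeff σ _, hcoeff σ _, hcoeff σ _, by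
      rw [map_sub]
      refine (abs_sub _ _).trans ?_
      have h1 := abs_conj_coeff_le_height P σ (expPair 0 0)
      have h2 := abs_conj_le_supAbs σ l
      nlinarith⟩)
    (f '' solutions P l) (by
      rintro _ ⟨v, hv, rfl⟩
      have h : eval v P = l := hv
      rw [← eval₂_id, eval₂_of_totalDegree_le_two _ _ _ hdeg.le] at h
      simp only [RingHom.id_apply] at h
      linear_combination h)
  refine ⟨Set.Finite.of_finite_image hfin hf.injOn, ?_⟩
  rwa [Set.ncard_image_of_injective _ hf] at hcard

end Polynomials

end TotReal

theorem lemma3 (F : Type*) [Field F] [NumberField F] [NumberField.IsTotallyReal F]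
    (ε : ℝ) (hε : 0 < ε) :
    (∃ C : ℝ, ∀ (P : MvPolynomial (Fin 2) (𝓞 F)), P.totalDegree = 2 →
      TotReal.HasTotPosDefQuadPart P → ∀ l : 𝓞 F,
        (TotReal.solutions P l).Finite ∧
        ((TotReal.solutions P l).ncard : ℝ) ≤
          C * (TotReal.height P * (1 + TotReal.supAbs l)) ^ ε) ∧
    (∃ C : ℝ, ∀ (Q : QuadraticForm (𝓞 F) (Fin 3 → 𝓞 F)), TotReal.TotPosDef Q →
      ∀ l : 𝓞 F, l ≠ 0 →
        (TotReal.representations Q l).Finite ∧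
        (TotReal.repNum Q l : ℝ) ≤
          C * TotReal.absNorm l ^ (1 / 2 : ℝ) *
            (TotReal.supAbs l * TotReal.absNorm (TotReal.disc Q)) ^ ε) ∧
    (∃ C : ℝ, ∀ (Q : QuadraticForm (𝓞 F) (Fin 4 → 𝓞 F)), TotReal.TotPosDef Q →
      ∀ l : 𝓞 F, l ≠ 0 →
        (TotReal.representations Q l).Finite ∧
        (TotReal.repNum Q l : ℝ) ≤
          C * TotReal.absNorm l *
            (TotReal.supAbs l * TotReal.absNorm (TotReal.disc Q)) ^ ε) := by
  refine ⟨TotReal.exists_polynomial_bound F hε, ?_, ?_⟩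
  · obtain ⟨K, hK1, hK⟩ := TotReal.exists_two_functionals F 3 (by norm_num)
    obtain ⟨C, -, hC⟩ := TotReal.exists_representation_bound F 1 K hK1 hε
    refine ⟨C, fun Q hQ l hl => ?_⟩
    obtain ⟨φ, hφ, hφb⟩ := hK (TotReal.formMatrix Q) hQ
    have h := hC Q hQ (fun _ => φ 0)
      (hφ.comp (fun _ : Fin 1 => 0) (Function.injective_of_subsingleton _))
      (fun _ => hφb 0) l hl
    rwa [pow_one, Real.sqrt_eq_rpow] at h
  · obtain ⟨K, hK1, hK⟩ := TotReal.exists_two_functionals F 4 (by norm_num)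
    obtain ⟨C, -, hC⟩ := TotReal.exists_representation_bound F 2 K hK1 hε
    refine ⟨C, fun Q hQ l hl => ?_⟩
    obtain ⟨φ, hφ, hφb⟩ := hK (TotReal.formMatrix Q) hQ
    have h := hC Q hQ φ hφ hφb l hl
    rwa [Real.sq_sqrt (show 0 ≤ TotReal.absNorm l from abs_nonneg _)] at h
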